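/- Let $n\ge 2$ and $0<\varepsilon\le 1$. A *weighted clique* on $[n]$ is a symmetric matrix $M\in\mathbb R_{\ge0}^{n\times n}$ with zero diagonal. It is a *graph metric* if $M(i,j)\le M(i,k)+M(j,k)$ for all $i,j,k$, and a *strict metric* if moreover $M(i,j)>0$ for all $i\ne j$. A matrix $M$ is *$\varepsilon$-far* from a class $\mathcal P$ of matrices if every $M'\in\mathcal P$ differs from $M$ in at least $\varepsilon n^2$ of the $n^2$ entries. A triangle on three vertices is *bad* if its largest edge weight exceeds the sum of the other two. The algorithm *Metric Testing* with parameter $C>0$ has query access to the entries of a matrix $M$ and works as follows. 1. (HighDegreeDetection) Draw $\lceil 3/\varepsilon^{1.1}\rceil$ vertices and $\lceil 12n^{2/3}\rceil$ edges (unordered pairs of distinct vertices), independently and uniformly, with replacement. For each pair of a sampled vertex $v$ and a sampled edge $\{a,b\}$ query the three entries of the triangle $v,a,b$; if it is bad, output NON-METRIC and stop. 2. (BadTriangleDetection) Draw $s=\lceil Cn^{1/3}/\varepsilon\rceil$ vertices independently and uniformly, with replacement, and query once the entry of each pair of them. If some triple of the sample is a bad triangle, output NON-METRIC; otherwise output METRIC.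 **Theorem.** There is an absolute constant $C_0>0$ such that for every $C\ge C_0$ there is a constant $K=K(C)$ for which the following holds for all $n\ge2$ and all $0<\varepsilon\le1$. - For every matrix $M\in\mathbb R^{n\times n}$ and every outcome of the random choices, the algorithm makes at most $K\,n^{2/3}/\varepsilon^2$ queries. - If $M$ is a graph metric (in particular if it is a strict metric), the algorithm outputs METRIC with probability $1$. - If $M$ is a weighted clique that is $\varepsilon$-far from the graph metrics, the algorithm outputs NON-METRIC with probability at least $2/3$. The same holds if $M$ is a weighted clique with $M(i,j)>0$ for all $i\ne j$ that is $\varepsilon$-far from the strict metrics. -/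

import Mathlib

/-! ### Distance matrices, metrics and farness -/

/-- The inputs of the tester: non-negative symmetric matrices with zero diagonal, i.e.
undirected non-negatively weighted cliques on the vertex set `Fin n`. -/
structure IsWeightedClique {n : ℕ} (M : Matrix (Fin n) (Fin n) ℝ) : Prop where
  nonneg : ∀ i j, 0 ≤ M i j
  symm : ∀ i j, M i j = M j i
  diag : ∀ i, M i i = 0

/-- A weighted clique is a metric graph if its weights satisfy the triangle inequality
(weight `0` is allowed between distinct vertices). -/
structure IsGraphMetric {n : ℕ} (M : Matrix (Fin n) (Fin n) ℝ) : Prop extends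
    IsWeightedClique M where
  triangle : ∀ i j k, M i j ≤ M i k + M j k

/-- A matrix is a (strict) metric if moreover distinct points have positive distance. -/
structure IsMetric {n : ℕ} (M : Matrix (Fin n) (Fin n) ℝ) : Prop extends
    IsGraphMetric M where
  pos : ∀ i j, i ≠ j → 0 < M i j

open Classical in
/-- The number of entries in which two matrices differ. -/
noncomputable def l0Dist {n : ℕ} (M M' : Matrix (Fin n) (Fin n) ℝ) : ℕ :=
  (Finset.univ.filter fun p : Fin n × Fin n => M p.1 p.2 ≠ M' p.1 p.2).card

/-- `M` is `ε`-far from the property `P`: it differs from every matrix with property `P`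
in at least `ε n ^ 2` entries. -/
def IsFar {n : ℕ} (ε : ℝ) (P : Matrix (Fin n) (Fin n) ℝ → Prop)
    (M : Matrix (Fin n) (Fin n) ℝ) : Prop :=
  ∀ M', P M' → ε * (n : ℝ) ^ 2 ≤ (l0Dist M M' : ℝ)

/-- Three edge weights form a bad triangle if the largest exceeds the sum of the two others. -/
def BadWeights (x y z : ℝ) : Prop :=
  x + y + z - max x (max y z) < max x (max y z)

/-! ### Algorithms with query access to a matrix -/

/-- A deterministic adaptive algorithm with query access to an `n × n` real matrix, as a
decision tree: it either stops with a result, or asks for one entry and continues in a way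
that may depend on the answer. -/
inductive QueryTree (n : ℕ) (α : Type) : Type where
  | done (a : α) : QueryTree n α
  | ask (i j : Fin n) (next : ℝ → QueryTree n α) : QueryTree n α

namespace QueryTree

/-- Sequential composition. -/
def bind {n : ℕ} {α β : Type} : QueryTree n α → (α → QueryTree n β) → QueryTree n β
  | done a, f => f a
  | ask i j next, f => ask i j fun x => (next x).bind f

/-- The result of running the algorithm on the matrix `M`. -/
def run {n : ℕ} {α : Type} (M : Matrix (Fin n) (Fin n) ℝ) : QueryTree n α → α
  | done a => a
  | ask i j next => (next (M i j)).run M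

/-- The number of queries made when the algorithm is run on the matrix `M`. -/
def queries {n : ℕ} {α : Type} (M : Matrix (Fin n) (Fin n) ℝ) : QueryTree n α → ℕ
  | done _ => 0
  | ask i j next => (next (M i j)).queries M + 1

end QueryTree

/-! ### The tester -/

/-- The edges of the clique on `Fin n`, each represented by its increasing pair of endpoints. -/
abbrev CliqueEdge (n : ℕ) : Type := {e : Fin n × Fin n // e.1 < e.2}

/-- Number of vertices sampled in the first phase: `3 / ε ^ 1.1`, rounded up. -/
noncomputable def numVertices (ε : ℝ) : ℕ := ⌈3 / ε ^ (1.1 : ℝ)⌉₊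

/-- Number of edges sampled in the first phase: `12 n ^ (2/3)`, rounded up. -/
noncomputable def numEdges (n : ℕ) : ℕ := ⌈12 * (n : ℝ) ^ (2 / 3 : ℝ)⌉₊

/-- Number of vertices sampled in the second phase: `C n ^ (1/3) / ε`, rounded up. -/
noncomputable def numSamples (C : ℝ) (n : ℕ) (ε : ℝ) : ℕ := ⌈C * (n : ℝ) ^ (1 / 3 : ℝ) / ε⌉₊

/-- The two possible outputs. -/
inductive Verdict : Type where
  | metric : Verdict
  | nonMetric : Verdict

open Classical in
/-- Go through a list of (vertex, edge) pairs, query the three sides of each triangle, and stop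
with the answer `true` as soon as a triangle inequality is violated; `false` if none is. -/
noncomputable def checkPairs {n : ℕ} : List (Fin n × CliqueEdge n) → QueryTree n Bool
  | [] => .done false
  | (v, e) :: l =>
      .ask v e.1.1 fun x => .ask v e.1.2 fun y => .ask e.1.1 e.1.2 fun z =>
        if BadWeights x y z then .done true else checkPairs l

/-- First phase: test all triangles formed by a sampled vertex and a sampled edge.
The result `true` stands for NON-METRIC, `false` for SUCCEEDED. -/
noncomputable def highDegreeDetection {n k m : ℕ} (V' : Fin k → Fin n)
    (E' : Fin m → CliqueEdge n) : QueryTree n Bool :=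
  checkPairs ((List.finRange k ×ˢ List.finRange m).map fun p => (V' p.1, E' p.2))

/-- Query all entries in a list of positions and return the table of the answers
(with value `0` at the positions that were not queried). -/
def queryTable {n : ℕ} : List (Fin n × Fin n) → QueryTree n (Fin n → Fin n → ℝ)
  | [] => .done fun _ _ => 0
  | (i, j) :: l => .ask i j fun x => (queryTable l).bind fun T =>
      .done fun a b => if a = i ∧ b = j then x else T a b

open Classical in
/-- The whole tester for given samples: run the first phase; if it found nothing, query all
pairs of the sample `S` once, and test all triples of the sample on the recorded answers. -/
noncomputable def badTriangleDetection {n k m s : ℕ} (V' : Fin k → Fin n)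
    (E' : Fin m → CliqueEdge n) (S : Fin s → Fin n) : QueryTree n Verdict :=
  (highDegreeDetection V' E').bind fun found =>
    if found = true then .done .nonMetric
    else
      (queryTable (((List.finRange s ×ˢ List.finRange s).filter fun p => p.1 < p.2).map
          fun p => (S p.1, S p.2))).bind fun T =>
        if ∃ p q r : Fin s, p < q ∧ q < r ∧
            BadWeights (T (S p) (S q)) (T (S p) (S r)) (T (S q) (S r))
        then .done .nonMetric else .done .metric

/-- The random choices of the tester: the vertices and edges of the first phase and the
vertices of the second phase. They are drawn independently and uniformly, so that the
triple is uniformly distributed on this finite type. -/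
abbrev Seed (C : ℝ) (n : ℕ) (ε : ℝ) : Type :=
  (Fin (numVertices ε) → Fin n) × (Fin (numEdges n) → CliqueEdge n) ×
    (Fin (numSamples C n ε) → Fin n)

/-- Metric Testing: the deterministic query algorithm run for a given outcome of the random
choices. -/
noncomputable def metricTesting (C : ℝ) (n : ℕ) (ε : ℝ) (ω : Seed C n ε) : QueryTree n Verdict :=
  badTriangleDetection ω.1 ω.2.1 ω.2.2

open Classical in
/-- The probability of an event under the uniform distribution on a finite non-empty type. -/
noncomputable def uniformProb {Ω : Type} [Fintype Ω] (A : Ω → Prop) : ℝ :=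
  ((Finset.univ.filter A).card : ℝ) / (Fintype.card Ω : ℝ)

/-- The probability that Metric Testing, run on `M`, outputs `r`. -/
noncomputable def outputProb (C : ℝ) {n : ℕ} (ε : ℝ) (M : Matrix (Fin n) (Fin n) ℝ)
    (r : Verdict) : ℝ :=
  uniformProb fun ω : Seed C n ε => (metricTesting C n ε ω).run M = r

/-! Soundness uses only the second phase. Choose a maximal family `T` of bad triples in which every
vertex has degree at most about `ε² n` and every pair degree at most about `ε n^(2/3)`. If `T` has
at least `ε³ n² / 32` members, the expected number of its members in the sample is a large constant,
and the degree bounds keep the second moment within a factor `3/2` of the squared mean. Hence the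
sample contains a bad triple with probability at least `2/3` (`sum_tripleCount_sq_le`,
`two_thirds_le_uniformProb_triple`).

If `T` is smaller, then few vertices `Z` and few pairs `F` have full degree, and by maximality every
bad triple is in `T`, meets `Z` or contains a pair of `F` (`exists_degreeBounded_cover`). It is
shown that `M` is then close to a metric. The vertices of `Z` are neutralised by giving all their
edges one huge weight. The rest is repaired by pivoting: all weights are clipped so that every
triangle at a vertex `i` becomes good. This creates no bad triple and changes only pairs that form a
bad triangle with `i`.

Averaged over pivots, the triples of `T` cost little per step. A pair of `F` could be paid for many
times, but a pivot that finds its weight too long leaves only strictly worse violators of that kind,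
and likewise for too short. As in the analysis of random records, a pair is hit about `2 log n`
times on average. The harmonic `potential` makes this deterministic
(`sum_card_le_sum_potential_drop`, `exists_cheap_pivot`). Once at most about `ε n / 4` vertices are
in bad triples, all weights among them may be changed. The total stays below `ε n²`
(`repair_bound`), which contradicts farness. Every repair step preserves positivity off the
diagonal, so strict metrics need no separate argument. -/

/-! ### Pivoting -/

/-- The value `x` clipped to the interval `[|a - b|, a + b]`. -/
noncomputable def clipValue (a b x : ℝ) : ℝ := max |a - b| (min x (a + b))

theorem abs_sub_le_clipValue (a b x : ℝ) : |a - b| ≤ clipValue a b x := le_max_left _ _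

theorem clipValue_le_add {a b : ℝ} (ha : 0 ≤ a) (hb : 0 ≤ b) (x : ℝ) :
    clipValue a b x ≤ a + b :=
  max_le (abs_le.2 ⟨by linarith, by linarith⟩) (min_le_right _ _)

theorem clipValue_comm (a b x : ℝ) : clipValue a b x = clipValue b a x := by
  simp [clipValue, abs_sub_comm, add_comm]

theorem clipValue_eq_self {a b x : ℝ} (h₁ : |a - b| ≤ x) (h₂ : x ≤ a + b) :
    clipValue a b x = x := by
  simp [clipValue, h₁, h₂]

theorem clipValue_of_le {a b x : ℝ} (h : x ≤ |a - b|) : clipValue a b x = |a - b| :=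
  max_eq_left ((min_le_left _ _).trans h)

theorem clipValue_of_add_le {a b x : ℝ} (ha : 0 ≤ a) (hb : 0 ≤ b) (h : a + b ≤ x) :
    clipValue a b x = a + b := by
  rw [clipValue, min_eq_right h, max_eq_right]
  exact abs_le.2 ⟨by linarith, by linarith⟩

/-- Clipping the three sides of a triangle preserves each single triangle inequality. -/
theorem clipValue_triangle {a b c x y z : ℝ} (ha : 0 ≤ a) (hb : 0 ≤ b) (hc : 0 ≤ c)
    (h : x ≤ y + z) : clipValue a b x ≤ clipValue a c y + clipValue b c z := by
  have h₁ := abs_sub_le_clipValue a c y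
  have h₂ := abs_sub_le_clipValue b c z
  have h₃ := clipValue_le_add ha hb x
  -- If `y` is cut down to `a + c`, the bound `|b - c|` below the other summand already gives `a +
  -- b` on the right; the same holds for `z`. Otherwise clipping lowers neither `y` nor `z`.
  rcases le_total y (a + c) with hy | hy
  · rcases le_total z (b + c) with hz | hz
    · have hy' : y ≤ clipValue a c y := by simp [clipValue, hy]
      have hz' : z ≤ clipValue b c z := by simp [clipValue, hz]
      refine max_le ?_ ?_
      · have := abs_sub_le a c b
        rw [abs_sub_comm c b] at this
        linarith
      · exact (min_le_left _ _).trans (by linarith)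
    · rw [clipValue_of_add_le hb hc hz]
      have := (abs_le.1 h₁).2
      linarith
  · rw [clipValue_of_add_le ha hc hy]
    have := (abs_le.1 h₂).2
    linarith

/-! ### Good triples and the pivot operation -/

/-- The triangle on `i`, `j`, `k` satisfies the three triangle inequalities. -/
def GoodTriple {n : ℕ} (M : Matrix (Fin n) (Fin n) ℝ) (i j k : Fin n) : Prop :=
  M i j ≤ M i k + M j k ∧ M i k ≤ M i j + M j k ∧ M j k ≤ M i j + M i k

theorem badWeights_iff {x y z : ℝ} :
    BadWeights x y z ↔ ¬ (x ≤ y + z ∧ y ≤ x + z ∧ z ≤ x + y) := by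
  unfold BadWeights
  constructor
  · rintro h ⟨h₁, h₂, h₃⟩
    have : max x (max y z) ≤ x + y + z - max x (max y z) := by
      rcases max_choice x (max y z) with hm | hm
      · rw [hm]; linarith
      · rcases max_choice y z with hn | hn <;> rw [hm, hn] <;> linarith
    linarith
  · intro h
    by_contra hc
    apply h
    have h₁ := le_max_left x (max y z)
    have h₂ : y ≤ max x (max y z) := (le_max_left y z).trans (le_max_right _ _)
    have h₃ : z ≤ max x (max y z) := (le_max_right y z).trans (le_max_right _ _)
    refine ⟨?_, ?_, ?_⟩ <;> linarith

theorem badWeights_iff_not_goodTriple {n : ℕ} (M : Matrix (Fin n) (Fin n) ℝ) (i j k : Fin n) :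
    BadWeights (M i j) (M i k) (M j k) ↔ ¬ GoodTriple M i j k := badWeights_iff

namespace IsWeightedClique

variable {n : ℕ} {M : Matrix (Fin n) (Fin n) ℝ}

theorem goodTriple_swap_left (hM : IsWeightedClique M) {i j k : Fin n} :
    GoodTriple M i j k ↔ GoodTriple M j i k := by
  unfold GoodTriple
  rw [hM.symm j i]
  constructor <;> rintro ⟨h₁, h₂, h₃⟩ <;> refine ⟨?_, ?_, ?_⟩ <;> linarith

theorem goodTriple_swap_right (hM : IsWeightedClique M) {i j k : Fin n} :
    GoodTriple M i j k ↔ GoodTriple M i k j := by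
  unfold GoodTriple
  rw [hM.symm k j]
  constructor <;> rintro ⟨h₁, h₂, h₃⟩ <;> refine ⟨?_, ?_, ?_⟩ <;> linarith

/-- This form singles out `i`: the weight of `j k` lies in the interval to which a pivot at `i`
clips it. -/
theorem goodTriple_iff_abs {i j k : Fin n} :
    GoodTriple M i j k ↔ |M i j - M i k| ≤ M j k ∧ M j k ≤ M i j + M i k := by
  unfold GoodTriple
  rw [abs_le]
  constructor
  · rintro ⟨h₁, h₂, h₃⟩; exact ⟨⟨by linarith, by linarith⟩, h₃⟩
  · rintro ⟨⟨h₁, h₂⟩, h₃⟩; exact ⟨by linarith, by linarith, h₃⟩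

theorem isGraphMetric_of_goodTriple (hM : IsWeightedClique M)
    (h : ∀ i j k, GoodTriple M i j k) : IsGraphMetric M :=
  { hM with triangle := fun i j k => (h i j k).1 }

end IsWeightedClique

theorem IsGraphMetric.goodTriple {n : ℕ} {M : Matrix (Fin n) (Fin n) ℝ} (hM : IsGraphMetric M)
    (i j k : Fin n) : GoodTriple M i j k := by
  refine ⟨hM.triangle i j k, ?_, ?_⟩
  · have := hM.triangle i k j
    rwa [hM.symm k j] at this
  · have := hM.triangle j k i
    rwa [hM.symm j i, hM.symm k i] at this

/-- The matrix obtained by clipping every weight so that all triangles at `i` become good. -/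
noncomputable def pivot {n : ℕ} (i : Fin n) (M : Matrix (Fin n) (Fin n) ℝ) :
    Matrix (Fin n) (Fin n) ℝ := fun j k => clipValue (M i j) (M i k) (M j k)

section Pivot

variable {n : ℕ} {M : Matrix (Fin n) (Fin n) ℝ}

theorem isWeightedClique_pivot (hM : IsWeightedClique M) (i : Fin n) :
    IsWeightedClique (pivot i M) where
  nonneg j k := (abs_nonneg _).trans (abs_sub_le_clipValue _ _ _)
  symm j k := by simp only [pivot]; rw [clipValue_comm, hM.symm j k]
  diag j := by
    have := hM.nonneg i j
    simp [pivot, clipValue, hM.diag, this]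

theorem pivot_pos (hM : IsWeightedClique M) (hpos : ∀ i j, i ≠ j → 0 < M i j) (i : Fin n) :
    ∀ j k, j ≠ k → 0 < pivot i M j k := by
  intro j k hjk
  refine lt_max_of_lt_right (lt_min (hpos j k hjk) ?_)
  by_cases hij : i = j
  · have := hpos i k (hij ▸ hjk)
    have := hM.nonneg i j
    linarith
  · have := hpos i j hij
    have := hM.nonneg i k
    linarith

theorem pivot_eq_of_goodTriple {i j k : Fin n} (h : GoodTriple M i j k) :
    pivot i M j k = M j k := by
  rw [IsWeightedClique.goodTriple_iff_abs] at h
  exact clipValue_eq_self h.1 h.2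

/-- A single triangle inequality survives pivoting. -/
theorem pivot_triangle (hM : IsWeightedClique M) (i : Fin n) {a b c : Fin n}
    (h : M a b ≤ M a c + M b c) : pivot i M a b ≤ pivot i M a c + pivot i M b c :=
  clipValue_triangle (hM.nonneg _ _) (hM.nonneg _ _) (hM.nonneg _ _) h

theorem goodTriple_pivot (hM : IsWeightedClique M) (i : Fin n) {a b c : Fin n}
    (h : GoodTriple M a b c) : GoodTriple (pivot i M) a b c := by
  have hP := isWeightedClique_pivot hM i
  obtain ⟨h₁, h₂, h₃⟩ := h
  refine ⟨pivot_triangle hM i h₁, ?_, ?_⟩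
  · rw [hM.symm b c] at h₂
    rw [hP.symm b c]
    exact pivot_triangle hM i h₂
  · rw [hM.symm a b, hM.symm a c] at h₃
    rw [hP.symm a b, hP.symm a c]
    exact pivot_triangle hM i h₃

theorem goodTriple_pivot_self (hM : IsWeightedClique M) (i j k : Fin n) :
    GoodTriple (pivot i M) i j k := by
  have hrow : ∀ l, pivot i M i l = M i l := fun l => by
    have := hM.nonneg i l
    simp [pivot, clipValue, hM.diag, abs_of_nonneg this]
  rw [IsWeightedClique.goodTriple_iff_abs, hrow, hrow]
  exact ⟨abs_sub_le_clipValue _ _ _, clipValue_le_add (hM.nonneg _ _) (hM.nonneg _ _) _⟩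

/-- If replacing the weight of `j k` by some `z` with the same clipped value makes the triangle
`w j k` good, then this triangle is good after pivoting. -/
theorem goodTriple_pivot_of_clipValue_eq (hM : IsWeightedClique M) {i j k w : Fin n} {z : ℝ}
    (hz : clipValue (M i j) (M i k) z = clipValue (M i j) (M i k) (M j k))
    (h₁ : |M w j - M w k| ≤ z) (h₂ : z ≤ M w j + M w k) : GoodTriple (pivot i M) w j k := by
  have hj := hM.nonneg i j
  have hk := hM.nonneg i k
  have hw := hM.nonneg i w
  rw [abs_le] at h₁
  refine ⟨?_, ?_, ?_⟩
  · simp only [pivot]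
    rw [← hz]
    have := clipValue_triangle hw hj hk (x := M w j) (y := M w k) (z := z) (by linarith)
    exact this
  · simp only [pivot]
    rw [← hz, clipValue_comm (M i j) (M i k)]
    have := clipValue_triangle hw hk hj (x := M w k) (y := M w j) (z := z) (by linarith)
    exact this
  · simp only [pivot]
    rw [← hz, clipValue_comm (M i w) (M i j), clipValue_comm (M i w) (M i k)]
    exact clipValue_triangle hj hk hw h₂

/-! ### The two kinds of violation at a pair, and their decrease under pivoting -/

open Classical in
/-- The vertices `w` for which the weight of `j k` is too large in the triangle `w j k`. -/
noncomputable def longAt (M : Matrix (Fin n) (Fin n) ℝ) (e : Fin n × Fin n) : Finset (Fin n) :=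
  Finset.univ.filter fun w => M w e.1 + M w e.2 < M e.1 e.2

open Classical in
/-- The vertices `w` for which the weight of `j k` is too small in the triangle `w j k`. -/
noncomputable def shortAt (M : Matrix (Fin n) (Fin n) ℝ) (e : Fin n × Fin n) : Finset (Fin n) :=
  Finset.univ.filter fun w => M e.1 e.2 < |M w e.1 - M w e.2|

theorem mem_longAt {e : Fin n × Fin n} {w : Fin n} :
    w ∈ longAt M e ↔ M w e.1 + M w e.2 < M e.1 e.2 := by simp [longAt]

theorem mem_shortAt {e : Fin n × Fin n} {w : Fin n} :
    w ∈ shortAt M e ↔ M e.1 e.2 < |M w e.1 - M w e.2| := by simp [shortAt]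

theorem not_goodTriple_iff {e : Fin n × Fin n} {w : Fin n} :
    ¬ GoodTriple M w e.1 e.2 ↔ w ∈ longAt M e ∨ w ∈ shortAt M e := by
  rw [IsWeightedClique.goodTriple_iff_abs, mem_longAt, mem_shortAt, not_and_or, not_le, not_le,
    or_comm]

theorem longAt_pivot_subset (hM : IsWeightedClique M) (i : Fin n) (e : Fin n × Fin n) :
    longAt (pivot i M) e ⊆ longAt M e := by
  intro w hw
  rw [mem_longAt] at hw ⊢
  by_contra! h
  have hP := isWeightedClique_pivot hM i
  rw [hM.symm w, hM.symm w] at h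
  rw [hP.symm w, hP.symm w] at hw
  linarith [pivot_triangle hM i h]

theorem shortAt_pivot_subset (hM : IsWeightedClique M) (i : Fin n) (e : Fin n × Fin n) :
    shortAt (pivot i M) e ⊆ shortAt M e := by
  intro w hw
  rw [mem_shortAt] at hw ⊢
  by_contra! h
  have hP := isWeightedClique_pivot hM i
  rw [abs_le] at h
  have h₁ : M w e.1 ≤ M w e.2 + M e.1 e.2 := by linarith
  have h₂ : M w e.2 ≤ M w e.1 + M e.2 e.1 := by rw [hM.symm e.2 e.1]; linarith
  have h₁' := pivot_triangle hM i h₁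
  have h₂' := pivot_triangle hM i h₂
  rw [hP.symm e.2 e.1] at h₂'
  exact absurd hw (not_lt.2 (abs_le.2 ⟨by linarith, by linarith⟩))

/-- The pivot cuts the weight down to `M i e.1 + M i e.2`. If `w` has at least this sum, replacing
the weight of `e` by the sum at `w` would make the triangle good, and the pivot clips both values to
the same number. The negated sums put both kinds of violation in the form `f i < f w`. -/
theorem longAt_pivot_subset_filter (hM : IsWeightedClique M) {i : Fin n} {e : Fin n × Fin n}
    (hi : i ∈ longAt M e) :
    longAt (pivot i M) e ⊆
      (longAt M e).filter fun w => -(M i e.1 + M i e.2) < -(M w e.1 + M w e.2) := by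
  intro w hw
  refine Finset.mem_filter.2 ⟨longAt_pivot_subset hM i e hw, ?_⟩
  by_contra! h
  rw [mem_longAt] at hi
  refine not_goodTriple_iff.2 (Or.inl hw) ?_
  have hj := hM.nonneg i e.1
  have hk := hM.nonneg i e.2
  have hwj := hM.nonneg w e.1
  have hwk := hM.nonneg w e.2
  refine goodTriple_pivot_of_clipValue_eq hM (z := M w e.1 + M w e.2) ?_ ?_ le_rfl
  · rw [clipValue_of_add_le hj hk (by linarith), clipValue_of_add_le hj hk hi.le]
  · exact abs_le.2 ⟨by linarith, by linarith⟩

/-- The mirror image: the weight is raised to `|M i e.1 - M i e.2|`, which repairs every `w` whose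
difference is no larger. -/
theorem shortAt_pivot_subset_filter (hM : IsWeightedClique M) {i : Fin n} {e : Fin n × Fin n}
    (hi : i ∈ shortAt M e) :
    shortAt (pivot i M) e ⊆
      (shortAt M e).filter fun w => |M i e.1 - M i e.2| < |M w e.1 - M w e.2| := by
  intro w hw
  refine Finset.mem_filter.2 ⟨shortAt_pivot_subset hM i e hw, ?_⟩
  by_contra! h
  rw [mem_shortAt] at hi
  refine not_goodTriple_iff.2 (Or.inr hw) ?_
  have hwj := hM.nonneg w e.1
  have hwk := hM.nonneg w e.2
  refine goodTriple_pivot_of_clipValue_eq hM (z := |M w e.1 - M w e.2|) ?_ le_rfl ?_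
  · rw [clipValue_of_le h, clipValue_of_le hi.le]
  · exact abs_le.2 ⟨by linarith, by linarith⟩

end Pivot

/-! ### The potential -/

theorem monotone_harmonic : Monotone fun k => (harmonic k : ℝ) := by
  refine monotone_nat_of_le_succ fun k => ?_
  rw [harmonic_succ]
  push_cast
  have : (0 : ℝ) ≤ ((k : ℝ) + 1)⁻¹ := by positivity
  linarith

/-- Adding a new minimum `a` to `s` gains `1 / (s.card + 1)` in each of the `s.card` old terms, and
the term of `a` is at least as much. The gain is thus at least `1`. -/
theorem card_le_sum_harmonic_sub {α : Type*} [DecidableEq α] (f : α → ℝ) (R : Finset α) :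
    (R.card : ℝ) ≤ ∑ i ∈ R, ((harmonic R.card : ℝ) -
      (harmonic (R.filter fun w => f i < f w).card : ℝ)) := by
  induction R using Finset.induction_on_min_value f with
  | empty => simp
  | insert a s ha hmin ih =>
    have hcount : ∀ i ∈ s, (insert a s).filter (fun w => f i < f w) =
        s.filter fun w => f i < f w := fun i hi => by
      rw [Finset.filter_insert, if_neg (not_lt.2 (hmin i hi))]
    have hself : (harmonic ((insert a s).filter fun w => f a < f w).card : ℝ) ≤
        harmonic s.card := by
      refine monotone_harmonic (Finset.card_le_card ?_)
      rw [Finset.filter_insert, if_neg (lt_irrefl _)]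
      exact Finset.filter_subset _ _
    rw [Finset.sum_insert ha, Finset.sum_congr rfl fun i hi => by rw [hcount i hi],
      Finset.card_insert_of_notMem ha]
    have hsucc : (harmonic (s.card + 1) : ℝ) = harmonic s.card + ((s.card : ℝ) + 1)⁻¹ := by
      rw [harmonic_succ]; push_cast; rfl
    have hsum : ∑ i ∈ s, ((harmonic (s.card + 1) : ℝ) -
          (harmonic (s.filter fun w => f i < f w).card : ℝ)) =
        ∑ i ∈ s, ((harmonic s.card : ℝ) - (harmonic (s.filter fun w => f i < f w).card : ℝ)) +
          s.card * ((s.card : ℝ) + 1)⁻¹ := by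
      rw [hsucc, ← nsmul_eq_mul, ← Finset.sum_const, ← Finset.sum_add_distrib]
      exact Finset.sum_congr rfl fun i _ => by ring
    rw [hsum, hsucc]
    have h1 : ((s.card : ℝ) + 1) * ((s.card : ℝ) + 1)⁻¹ = 1 := mul_inv_cancel₀ (by positivity)
    push_cast
    linarith

/-- If `g i ⊆ R` for all `i`, and `g i` is contained in the part of `R` above `i` for `i ∈ R`,
then the harmonic numbers of the cardinalities drop by `R.card` in total. -/
theorem card_le_sum_harmonic_drop {α : Type*} [Fintype α] [DecidableEq α] (f : α → ℝ)
    (R : Finset α) (g : α → Finset α) (hg : ∀ i, g i ⊆ R)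
    (hg' : ∀ i ∈ R, g i ⊆ R.filter fun w => f i < f w) :
    (R.card : ℝ) ≤ ∑ i, ((harmonic R.card : ℝ) - (harmonic (g i).card : ℝ)) :=
  calc (R.card : ℝ) ≤ ∑ i ∈ R, ((harmonic R.card : ℝ) -
        (harmonic (R.filter fun w => f i < f w).card : ℝ)) := card_le_sum_harmonic_sub f R
    _ ≤ ∑ i ∈ R, ((harmonic R.card : ℝ) - (harmonic (g i).card : ℝ)) :=
        Finset.sum_le_sum fun i hi =>
          sub_le_sub_left (monotone_harmonic (Finset.card_le_card (hg' i hi))) _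
    _ ≤ _ := Finset.sum_le_sum_of_subset_of_nonneg (Finset.subset_univ _) fun i _ _ =>
        sub_nonneg.2 (monotone_harmonic (Finset.card_le_card (hg i)))

/-- The potential of a set of pairs: it bounds the expected number of times that these pairs
lie in a bad triangle with a random pivot. -/
noncomputable def potential {n : ℕ} (F : Finset (Fin n × Fin n))
    (M : Matrix (Fin n) (Fin n) ℝ) : ℝ :=
  ∑ e ∈ F, ((harmonic (longAt M e).card : ℝ) + (harmonic (shortAt M e).card : ℝ))

/-- For a uniformly random pivot, the expected drop of the potential pays for the expected number of
violations at pairs of `F`. -/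
theorem sum_card_le_sum_potential_drop {n : ℕ} {M : Matrix (Fin n) (Fin n) ℝ}
    (hM : IsWeightedClique M) (F : Finset (Fin n × Fin n)) :
    ∑ e ∈ F, (((longAt M e).card : ℝ) + ((shortAt M e).card : ℝ)) ≤
      ∑ i, (potential F M - potential F (pivot i M)) := by
  simp only [potential, ← Finset.sum_sub_distrib]
  rw [Finset.sum_comm]
  refine Finset.sum_le_sum fun e _ => ?_
  have h₁ := card_le_sum_harmonic_drop (fun w => -(M w e.1 + M w e.2)) (longAt M e)
    (fun i => longAt (pivot i M) e) (fun i => longAt_pivot_subset hM i e)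
    (fun i hi => longAt_pivot_subset_filter hM hi)
  have h₂ := card_le_sum_harmonic_drop (fun w => |M w e.1 - M w e.2|) (shortAt M e)
    (fun i => shortAt (pivot i M) e) (fun i => shortAt_pivot_subset hM i e)
    (fun i hi => shortAt_pivot_subset_filter hM hi)
  refine (add_le_add h₁ h₂).trans (le_of_eq ?_)
  rw [← Finset.sum_add_distrib]
  exact Finset.sum_congr rfl fun i _ => by ring

theorem potential_le {n : ℕ} (F : Finset (Fin n × Fin n)) (M : Matrix (Fin n) (Fin n) ℝ) :
    potential F M ≤ F.card * (2 * (harmonic n : ℝ)) := by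
  rw [potential, ← nsmul_eq_mul]
  refine Finset.sum_le_card_nsmul _ _ _ fun e _ => ?_
  have h : ∀ s : Finset (Fin n), (harmonic s.card : ℝ) ≤ harmonic n := fun s =>
    monotone_harmonic ((Finset.card_le_univ s).trans_eq (Fintype.card_fin n))
  linarith [h (longAt M e), h (shortAt M e)]

theorem potential_nonneg {n : ℕ} (F : Finset (Fin n × Fin n)) (M : Matrix (Fin n) (Fin n) ℝ) :
    0 ≤ potential F M := by
  have h : ∀ k, (0 : ℝ) ≤ harmonic k := fun k => by
    have := monotone_harmonic (Nat.zero_le k)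
    simpa using this
  exact Finset.sum_nonneg fun e _ => add_nonneg (h _) (h _)

/-! ### Repairing a matrix by pivoting -/

theorem l0Dist_triangle {n : ℕ} (M M' M'' : Matrix (Fin n) (Fin n) ℝ) :
    l0Dist M M'' ≤ l0Dist M M' + l0Dist M' M'' := by
  classical
  unfold l0Dist
  refine le_trans (Finset.card_le_card ?_) (Finset.card_union_le _ _)
  intro p hp
  simp only [Finset.mem_union, Finset.mem_filter, Finset.mem_univ, true_and] at hp ⊢
  by_contra! h
  exact hp (h.1.trans h.2)

theorem l0Dist_le_card {n : ℕ} {M M' : Matrix (Fin n) (Fin n) ℝ} (s : Finset (Fin n × Fin n))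
    (h : ∀ i j, M i j ≠ M' i j → (i, j) ∈ s) : l0Dist M M' ≤ s.card := by
  classical
  unfold l0Dist
  refine Finset.card_le_card fun p hp => h p.1 p.2 ?_
  simpa using hp

section Repair

variable {n : ℕ} {M : Matrix (Fin n) (Fin n) ℝ}

/-- All bad triples have their vertices in `A`. -/
def BadWithin (A : Finset (Fin n)) (M : Matrix (Fin n) (Fin n) ℝ) : Prop :=
  ∀ i j k, ¬ GoodTriple M i j k → i ∈ A

/-- Every bad triple belongs to `T` or contains a pair from `F`. -/
def BadCoveredBy (T : Finset (Fin n × Fin n × Fin n)) (F : Finset (Fin n × Fin n))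
    (M : Matrix (Fin n) (Fin n) ℝ) : Prop :=
  ∀ i j k, ¬ GoodTriple M i j k → (i, j, k) ∈ T ∨ (i, j) ∈ F ∨ (i, k) ∈ F ∨ (j, k) ∈ F

theorem BadWithin.mem_and_mem (hM : IsWeightedClique M) {A : Finset (Fin n)}
    (hA : BadWithin A M) {i j k : Fin n} (h : ¬ GoodTriple M i j k) : j ∈ A ∧ k ∈ A := by
  rw [hM.goodTriple_swap_left] at h
  refine ⟨hA _ _ _ h, ?_⟩
  rw [hM.goodTriple_swap_right, hM.goodTriple_swap_left] at h
  exact hA _ _ _ h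

theorem BadWithin.pivot (hM : IsWeightedClique M) {A : Finset (Fin n)} (hA : BadWithin A M)
    (i : Fin n) : BadWithin (A.erase i) (pivot i M) := by
  intro a b c h
  refine Finset.mem_erase.2 ⟨?_, hA _ _ _ fun hg => h (goodTriple_pivot hM i hg)⟩
  rintro rfl
  exact h (goodTriple_pivot_self hM _ _ _)

theorem BadCoveredBy.pivot (hM : IsWeightedClique M) {T : Finset (Fin n × Fin n × Fin n)}
    {F : Finset (Fin n × Fin n)} (h : BadCoveredBy T F M) (i : Fin n) :
    BadCoveredBy T F (pivot i M) :=
  fun a b c hb => h a b c fun hg => hb (goodTriple_pivot hM i hg)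

/-- Pivoting once at each vertex of `A` removes all bad triples, and a pivot changes only pairs in
bad triples. This is the final stage of the repair, where `A` is small. -/
theorem exists_isGraphMetric_of_badWithin (A : Finset (Fin n)) :
    ∀ M : Matrix (Fin n) (Fin n) ℝ, IsWeightedClique M → BadWithin A M →
      ∃ M', IsGraphMetric M' ∧ ((∀ i j, i ≠ j → 0 < M i j) → ∀ i j, i ≠ j → 0 < M' i j) ∧
        ∀ i j, M i j ≠ M' i j → i ∈ A ∧ j ∈ A := by
  induction A using Finset.induction_on with
  | empty =>
    intro M hM hA
    refine ⟨M, hM.isGraphMetric_of_goodTriple fun i j k => ?_, fun h => h, fun i j h => absurd rfl h⟩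
    by_contra h
    simpa using hA i j k h
  | insert a s ha ih =>
    intro M hM hA
    have hA' := hA.pivot hM a
    rw [Finset.erase_insert ha] at hA'
    obtain ⟨M', hM', hpos, hdiff⟩ := ih _ (isWeightedClique_pivot hM a) hA'
    refine ⟨M', hM', fun h => hpos (pivot_pos hM h a), fun i j hij => ?_⟩
    by_cases h : pivot a M i j = M' i j
    · exact hA.mem_and_mem hM fun hg => hij ((pivot_eq_of_goodTriple hg).symm.trans h)
    · exact ⟨Finset.mem_insert_of_mem (hdiff i j h).1, Finset.mem_insert_of_mem (hdiff i j h).2⟩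

open Classical in
theorem sum_l0Dist_pivot_le (M : Matrix (Fin n) (Fin n) ℝ) :
    ∑ i, l0Dist M (pivot i M) ≤
      (Finset.univ.filter fun t : Fin n × Fin n × Fin n =>
        ¬ GoodTriple M t.1 t.2.1 t.2.2).card := by
  have h : ∀ i, l0Dist M (pivot i M) ≤
      (Finset.univ.filter fun p : Fin n × Fin n => ¬ GoodTriple M i p.1 p.2).card := fun i =>
    l0Dist_le_card _ fun j k hjk => by
      simp only [Finset.mem_filter, Finset.mem_univ, true_and]
      exact fun hg => hjk (pivot_eq_of_goodTriple hg).symm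
  refine (Finset.sum_le_sum fun i _ => h i).trans (le_of_eq ?_)
  simp only [Finset.card_filter]
  rw [Fintype.sum_prod_type]

open Classical in
theorem card_badTriples_le (hM : IsWeightedClique M) {T : Finset (Fin n × Fin n × Fin n)}
    {F : Finset (Fin n × Fin n)} (h : BadCoveredBy T F M) :
    (Finset.univ.filter fun t : Fin n × Fin n × Fin n => ¬ GoodTriple M t.1 t.2.1 t.2.2).card ≤
      T.card + 3 * ∑ e ∈ F, ((longAt M e).card + (shortAt M e).card) := by
  -- `g` inserts the third vertex in one of three positions relative to the pair; this is the source
  -- of the factor `3`.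
  let B : (Fin n × Fin n → Fin n → Fin n × Fin n × Fin n) → Finset (Fin n × Fin n × Fin n) :=
    fun g => F.biUnion fun e => (longAt M e ∪ shortAt M e).image (g e)
  have hB : ∀ g, (B g).card ≤ ∑ e ∈ F, ((longAt M e).card + (shortAt M e).card) := fun g =>
    Finset.card_biUnion_le.trans <| Finset.sum_le_sum fun e _ =>
      Finset.card_image_le.trans (Finset.card_union_le _ _)
  have hmem : ∀ g e w, e ∈ F → ¬ GoodTriple M w e.1 e.2 → g e w ∈ B g := fun g e w he hw =>
    Finset.mem_biUnion.2 ⟨e, he, Finset.mem_image_of_mem _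
      (Finset.mem_union.2 (not_goodTriple_iff.1 hw))⟩
  have hsub : (Finset.univ.filter fun t : Fin n × Fin n × Fin n =>
      ¬ GoodTriple M t.1 t.2.1 t.2.2) ⊆
      T ∪ (B (fun e w => (e.1, e.2, w)) ∪
        (B (fun e w => (e.1, w, e.2)) ∪ B (fun e w => (w, e.1, e.2)))) := by
    rintro ⟨i, j, k⟩ ht
    simp only [Finset.mem_filter, Finset.mem_univ, true_and] at ht
    simp only [Finset.mem_union]
    rcases h i j k ht with h | h | h | h
    · exact Or.inl h
    · refine Or.inr (Or.inl (hmem (fun e w => (e.1, e.2, w)) (i, j) k h ?_))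
      rwa [hM.goodTriple_swap_left, hM.goodTriple_swap_right]
    · refine Or.inr (Or.inr (Or.inl (hmem (fun e w => (e.1, w, e.2)) (i, k) j h ?_)))
      rwa [hM.goodTriple_swap_left]
    · exact Or.inr (Or.inr (Or.inr (hmem (fun e w => (w, e.1, e.2)) (j, k) i h ht)))
  refine (Finset.card_le_card hsub).trans ((Finset.card_union_le _ _).trans ?_)
  have h₁ := hB fun e w => (e.1, e.2, w)
  have h₂ := hB fun e w => (e.1, w, e.2)
  have h₃ := hB fun e w => (w, e.1, e.2)
  have h₄ := Finset.card_union_le (B (fun e w => (e.1, e.2, w)))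
    (B (fun e w => (e.1, w, e.2)) ∪ B (fun e w => (w, e.1, e.2)))
  have h₅ := Finset.card_union_le (B (fun e w => (e.1, w, e.2))) (B (fun e w => (w, e.1, e.2)))
  omega

theorem pivot_eq_self_of_notMem {A : Finset (Fin n)} (hA : BadWithin A M) {i : Fin n}
    (hi : i ∉ A) : pivot i M = M := by
  ext j k
  refine pivot_eq_of_goodTriple ?_
  by_contra h
  exact hi (hA i j k h)

/-- Some vertex is a cheap pivot, if its cost is compared to the drop of the potential. -/
theorem exists_cheap_pivot (hM : IsWeightedClique M) {T : Finset (Fin n × Fin n × Fin n)}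
    {F : Finset (Fin n × Fin n)} (hTF : BadCoveredBy T F M) {A : Finset (Fin n)}
    (hA : BadWithin A M) (hne : A.Nonempty) :
    ∃ i ∈ A, (l0Dist M (pivot i M) : ℝ) + 3 * potential F (pivot i M) ≤
      3 * potential F M + T.card / A.card := by
  classical
  by_contra! hc
  have hcard : (0 : ℝ) < A.card := by exact_mod_cast hne.card_pos
  have h₁ : ∑ i ∈ A, (3 * potential F M + T.card / A.card) <
      ∑ i ∈ A, ((l0Dist M (pivot i M) : ℝ) + 3 * potential F (pivot i M)) :=
    Finset.sum_lt_sum_of_nonempty hne hc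
  have h₂ : ∑ i ∈ A, (3 * potential F M + T.card / A.card) =
      ∑ i ∈ A, 3 * potential F M + T.card := by
    rw [Finset.sum_add_distrib]
    congr 1
    rw [Finset.sum_const, nsmul_eq_mul]
    field_simp
  have h₃ : (∑ i ∈ A, (l0Dist M (pivot i M) : ℝ)) ≤
      T.card + 3 * ∑ e ∈ F, (((longAt M e).card : ℝ) + ((shortAt M e).card : ℝ)) := by
    refine (Finset.sum_le_sum_of_subset_of_nonneg (Finset.subset_univ A)
      fun _ _ _ => Nat.cast_nonneg _).trans ?_
    exact_mod_cast (sum_l0Dist_pivot_le M).trans (card_badTriples_le hM hTF)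
  -- Pivots outside `A` change nothing, so the average may be taken over `A` alone.
  have h₄ : ∑ i, (potential F M - potential F (pivot i M)) =
      ∑ i ∈ A, (potential F M - potential F (pivot i M)) := by
    refine (Finset.sum_subset (Finset.subset_univ A) fun i _ hi => ?_).symm
    rw [pivot_eq_self_of_notMem hA hi, sub_self]
  have h₅ := sum_card_le_sum_potential_drop hM F
  rw [h₄, Finset.sum_sub_distrib] at h₅
  rw [h₂, Finset.sum_add_distrib, ← Finset.mul_sum, ← Finset.mul_sum] at h₁
  linarith

/-- Cheap pivots are made while more than `w` vertices remain. Their potential terms telescope, and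
each adds at most `T.card / w`. The last `w` vertices cost at most `w ^ 2`. The same `T` and `F`
serve throughout, as pivoting creates no bad triple. -/
theorem exists_isGraphMetric_near {T : Finset (Fin n × Fin n × Fin n)}
    {F : Finset (Fin n × Fin n)} {w : ℕ} (hw : 0 < w) (N : ℕ) :
    ∀ (A : Finset (Fin n)) (M : Matrix (Fin n) (Fin n) ℝ), A.card = N → IsWeightedClique M →
      BadCoveredBy T F M → BadWithin A M →
      ∃ M', IsGraphMetric M' ∧ ((∀ i j, i ≠ j → 0 < M i j) → ∀ i j, i ≠ j → 0 < M' i j) ∧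
        (l0Dist M M' : ℝ) ≤ 3 * potential F M + N * (T.card / w) + (w : ℝ) ^ 2 := by
  classical
  induction N with
  | zero =>
    intro A M hcard hM hTF hA
    obtain ⟨M', hM', hpos, hdiff⟩ := exists_isGraphMetric_of_badWithin A M hM hA
    refine ⟨M', hM', hpos, ?_⟩
    have h : l0Dist M M' ≤ 0 := by
      simpa [hcard] using l0Dist_le_card (A ×ˢ A) fun i j hij => Finset.mem_product.2 (hdiff i j hij)
    have h' : (l0Dist M M' : ℝ) ≤ 0 := by exact_mod_cast h
    have := potential_nonneg F M
    simp only [Nat.cast_zero, zero_mul]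
    nlinarith [sq_nonneg (w : ℝ)]
  | succ N ih =>
    intro A M hcard hM hTF hA
    have hp := potential_nonneg F M
    have hwR : (0 : ℝ) < w := by exact_mod_cast hw
    rcases le_or_gt A.card w with hle | hlt
    · obtain ⟨M', hM', hpos, hdiff⟩ := exists_isGraphMetric_of_badWithin A M hM hA
      refine ⟨M', hM', hpos, ?_⟩
      have h := l0Dist_le_card (A ×ˢ A) fun i j hij => Finset.mem_product.2 (hdiff i j hij)
      rw [Finset.card_product] at h
      have h' : (l0Dist M M' : ℝ) ≤ (w : ℝ) ^ 2 := by
        rw [sq]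
        exact_mod_cast h.trans (Nat.mul_le_mul hle hle)
      have : (0 : ℝ) ≤ ((N + 1 : ℕ) : ℝ) * (T.card / w) := by positivity
      linarith
    · obtain ⟨i, hi, hcost⟩ := exists_cheap_pivot hM hTF hA
        (Finset.card_pos.1 (by omega))
      obtain ⟨M', hM', hpos, hdist⟩ := ih (A.erase i) (pivot i M)
        (by rw [Finset.card_erase_of_mem hi, hcard, Nat.add_sub_cancel])
        (isWeightedClique_pivot hM i) (hTF.pivot hM i) (hA.pivot hM i)
      refine ⟨M', hM', fun h => hpos (pivot_pos hM h i), ?_⟩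
      have h₁ : (l0Dist M M' : ℝ) ≤ l0Dist M (pivot i M) + l0Dist (pivot i M) M' := by
        exact_mod_cast l0Dist_triangle _ _ _
      have h₂ : (T.card : ℝ) / A.card ≤ T.card / w :=
        div_le_div_of_nonneg_left (Nat.cast_nonneg _) hwR (by exact_mod_cast hlt.le)
      push_cast
      linarith

/-! ### Neutralising the vertices of high degree, and the repair theorem -/

/-- Replacing all weights at `Z` by a constant `D`. -/
def isolate (Z : Finset (Fin n)) (D : ℝ) (M : Matrix (Fin n) (Fin n) ℝ) :
    Matrix (Fin n) (Fin n) ℝ :=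
  fun i j => if i = j then 0 else if i ∈ Z ∨ j ∈ Z then D else M i j

theorem isWeightedClique_isolate (hM : IsWeightedClique M) (Z : Finset (Fin n)) {D : ℝ}
    (hD : 0 ≤ D) : IsWeightedClique (isolate Z D M) where
  nonneg i j := by
    unfold isolate
    split_ifs
    exacts [le_rfl, hD, hM.nonneg i j]
  symm i j := by
    unfold isolate
    simp only [eq_comm (a := i), or_comm (a := i ∈ Z), hM.symm i j]
  diag i := by simp [isolate]

theorem goodTriple_isolate_of_mem (hM : IsWeightedClique M) {Z : Finset (Fin n)} {D : ℝ}
    (hD : ∀ i j, M i j ≤ D) {i j k : Fin n} (h : i ∈ Z) :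
    GoodTriple (isolate Z D M) i j k := by
  have hD₀ : 0 ≤ D := (hM.nonneg i i).trans (hD i i)
  unfold GoodTriple isolate
  by_cases hij : i = j <;> by_cases hik : i = k <;> by_cases hjk : j = k <;>
    by_cases hj : j ∈ Z <;> by_cases hk : k ∈ Z <;>
    simp_all
  -- The case left over has sides `D`, `D` and `M j k`, with three distinct vertices.
  exact ⟨hM.nonneg j k, by linarith [hD j k]⟩

theorem goodTriple_isolate (hM : IsWeightedClique M) {Z : Finset (Fin n)} {D : ℝ}
    (hD : ∀ i j, M i j ≤ D) {i j k : Fin n} (h : GoodTriple M i j k) :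
    GoodTriple (isolate Z D M) i j k := by
  have hI := isWeightedClique_isolate hM Z ((hM.nonneg i i).trans (hD i i))
  by_cases hi : i ∈ Z
  · exact goodTriple_isolate_of_mem hM hD hi
  by_cases hj : j ∈ Z
  · rw [hI.goodTriple_swap_left]
    exact goodTriple_isolate_of_mem hM hD hj
  by_cases hk : k ∈ Z
  · rw [hI.goodTriple_swap_right, hI.goodTriple_swap_left]
    exact goodTriple_isolate_of_mem hM hD hk
  have hdiag := hM.diag
  have hrow : ∀ a b, a ∉ Z → b ∉ Z → isolate Z D M a b = M a b := fun a b ha hb => by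
    unfold isolate
    split_ifs with h₁ h₂
    · rw [h₁, hdiag]
    · exact absurd h₂ (by tauto)
    · rfl
  unfold GoodTriple
  rwa [hrow i j hi hj, hrow i k hi hk, hrow j k hj hk]

theorem l0Dist_isolate_le (hM : IsWeightedClique M) (Z : Finset (Fin n)) (D : ℝ) :
    l0Dist M (isolate Z D M) ≤ 2 * (Z.card * n) := by
  classical
  have h := l0Dist_le_card (M := M) (M' := isolate Z D M)
    (Z ×ˢ Finset.univ ∪ Finset.univ ×ˢ Z) fun i j hij => by
      unfold isolate at hij
      simp only [Finset.mem_union, Finset.mem_product, Finset.mem_univ, and_true, true_and]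
      split_ifs at hij with h₁ h₂
      · exact absurd (h₁ ▸ hM.diag i) hij
      · exact h₂
      · exact absurd rfl hij
  refine h.trans ((Finset.card_union_le _ _).trans (le_of_eq ?_))
  simp only [Finset.card_product, Finset.card_univ, Fintype.card_fin]
  ring

/-- The repair theorem: if all bad triples that avoid `Z` belong to `T` or contain a pair of `F`,
then the matrix is close to a metric. -/
theorem exists_isGraphMetric_l0Dist_le (hM : IsWeightedClique M)
    (T : Finset (Fin n × Fin n × Fin n)) (F : Finset (Fin n × Fin n)) (Z : Finset (Fin n))
    (hcover : ∀ i j k, ¬ GoodTriple M i j k → i ∉ Z → j ∉ Z → k ∉ Z →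
      (i, j, k) ∈ T ∨ (i, j) ∈ F ∨ (i, k) ∈ F ∨ (j, k) ∈ F) {w : ℕ} (hw : 0 < w) :
    ∃ M', IsGraphMetric M' ∧ ((∀ i j, i ≠ j → 0 < M i j) → ∀ i j, i ≠ j → 0 < M' i j) ∧
      (l0Dist M M' : ℝ) ≤
        2 * (Z.card * n) + 6 * (F.card * (harmonic n : ℝ)) + n * (T.card / w) + (w : ℝ) ^ 2 := by
  -- `D` must also be positive, so that strict positivity survives the isolation.
  obtain ⟨D, hD₀, hD⟩ : ∃ D : ℝ, 0 < D ∧ ∀ i j, M i j ≤ D := by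
    refine ⟨1 + ∑ p : Fin n × Fin n, M p.1 p.2, ?_, fun i j => ?_⟩
    · have : 0 ≤ ∑ p : Fin n × Fin n, M p.1 p.2 := Finset.sum_nonneg fun p _ => hM.nonneg _ _
      linarith
    · have := Finset.single_le_sum (f := fun p : Fin n × Fin n => M p.1 p.2)
        (fun p _ => hM.nonneg _ _) (Finset.mem_univ (i, j))
      linarith
  have hI := isWeightedClique_isolate hM Z hD₀.le
  have hTF : BadCoveredBy T F (isolate Z D M) := fun i j k hb => by
    refine hcover i j k (fun hg => hb (goodTriple_isolate hM hD hg)) ?_ ?_ ?_ <;> intro hZ <;>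
      apply hb
    · exact goodTriple_isolate_of_mem hM hD hZ
    · rw [hI.goodTriple_swap_left]
      exact goodTriple_isolate_of_mem hM hD hZ
    · rw [hI.goodTriple_swap_right, hI.goodTriple_swap_left]
      exact goodTriple_isolate_of_mem hM hD hZ
  obtain ⟨M', hM', hpos, hdist⟩ := exists_isGraphMetric_near hw n Finset.univ (isolate Z D M)
    (by simp) hI hTF fun i _ _ _ => Finset.mem_univ i
  refine ⟨M', hM', fun h => hpos fun i j hij => ?_, ?_⟩
  · unfold isolate
    rw [if_neg hij]
    split_ifs
    exacts [hD₀, h i j hij]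
  · have h₁ : (l0Dist M M' : ℝ) ≤ l0Dist M (isolate Z D M) + l0Dist (isolate Z D M) M' := by
      exact_mod_cast l0Dist_triangle _ _ _
    have h₂ : (l0Dist M (isolate Z D M) : ℝ) ≤ 2 * (Z.card * n) := by
      exact_mod_cast l0Dist_isolate_le hM Z D
    have h₃ := potential_le F (isolate Z D M)
    linarith

end Repair

/-! ### Maximal families of bounded degree -/

theorem card_filter_insert_le {τ K : Type*} [DecidableEq τ] [DecidableEq K] {f : τ → K} {b : ℕ}
    {T : Finset τ} {t : τ} (hb : ∀ k, (T.filter fun t => f t = k).card ≤ b)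
    (hne : (T.filter fun t' => f t' = f t).card ≠ b) (k : K) :
    ((insert t T).filter fun t => f t = k).card ≤ b := by
  rw [Finset.filter_insert]
  split_ifs with h
  · rw [← h]
    exact (Finset.card_insert_le _ _).trans (lt_of_le_of_ne (hb _) hne)
  · exact hb k

/-- A maximal subfamily of `B` in which no value of a key function is taken too often: every other
member of `B` shares a key that is already taken as often as allowed. -/
theorem exists_maximal_subfamily {τ ι K L : Type*} [DecidableEq K] [DecidableEq L]
    (κ : ι → τ → K) (ρ : ι → τ → L) (D d : ℕ) (B : Finset τ) :
    ∃ T ⊆ B, (∀ i k, (T.filter fun t => κ i t = k).card ≤ D) ∧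
      (∀ i k, (T.filter fun t => ρ i t = k).card ≤ d) ∧
      ∀ t ∈ B, t ∉ T → (∃ i, (T.filter fun t' => κ i t' = κ i t).card = D) ∨
        ∃ i, (T.filter fun t' => ρ i t' = ρ i t).card = d := by
  classical
  let P : Finset τ → Prop := fun T => (∀ i k, (T.filter fun t => κ i t = k).card ≤ D) ∧
      ∀ i k, (T.filter fun t => ρ i t = k).card ≤ d
  have hne : (B.powerset.filter P).Nonempty := ⟨∅, by simp [P]⟩
  obtain ⟨T, hT, hmax⟩ := Finset.exists_max_image _ Finset.card hne
  rw [Finset.mem_filter, Finset.mem_powerset] at hT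
  refine ⟨T, hT.1, hT.2.1, hT.2.2, fun t htB htT => ?_⟩
  by_contra! hc
  have := hmax (insert t T) (Finset.mem_filter.2 ⟨Finset.mem_powerset.2
    (Finset.insert_subset htB hT.1), fun i => card_filter_insert_le (hT.2.1 i) (hc.1 i),
    fun i => card_filter_insert_le (hT.2.2 i) (hc.2 i)⟩)
  rw [Finset.card_insert_of_notMem htT] at this
  omega

theorem card_full_mul_le {τ K : Type*} [Fintype K] [DecidableEq K] (κ : τ → K) (T : Finset τ) (b : ℕ) :
    (Finset.univ.filter fun k => (T.filter fun t => κ t = k).card = b).card * b ≤ T.card := by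
  calc _ = ∑ k ∈ Finset.univ.filter fun k => (T.filter fun t => κ t = k).card = b,
        (T.filter fun t => κ t = k).card := by
        rw [← smul_eq_mul, ← Finset.sum_const]
        exact Finset.sum_congr rfl fun k hk => (Finset.mem_filter.1 hk).2.symm
    _ ≤ ∑ k, (T.filter fun t => κ t = k).card :=
        Finset.sum_le_sum_of_subset (Finset.subset_univ _)
    _ = T.card := (Finset.card_eq_sum_card_fiberwise fun t _ => Finset.mem_univ _).symm

/-- The three vertices of a triple. -/
def tripleVertex {V : Type*} (i : Fin 3) (t : V × V × V) : V := ![t.1, t.2.1, t.2.2] i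

/-- The three pairs in a triple. -/
def triplePair {V : Type*} (i : Fin 3) (t : V × V × V) : V × V :=
  ![(t.1, t.2.1), (t.1, t.2.2), (t.2.1, t.2.2)] i

/-- In the family `T`, every vertex occurs at most `D` times and every pair at most `d` times
in each position. -/
def DegreeBounded {V : Type*} [DecidableEq V] (T : Finset (V × V × V)) (D d : ℕ) : Prop :=
  (∀ i v, (T.filter fun t => tripleVertex i t = v).card ≤ D) ∧
    ∀ i e, (T.filter fun t => triplePair i t = e).card ≤ d

/-- `F` and `Z` collect the pairs and vertices of full degree in some position. The fibres over
distinct keys are disjoint, so each of the three positions contributes at most `T.card` to the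
products. -/
theorem exists_degreeBounded_cover {V : Type*} [Fintype V] [DecidableEq V] (B : Finset (V × V × V)) (D d : ℕ) :
    ∃ T ⊆ B, DegreeBounded T D d ∧ ∃ (F : Finset (V × V)) (Z : Finset V),
      F.card * d ≤ 3 * T.card ∧ Z.card * D ≤ 3 * T.card ∧
      ∀ i j k, (i, j, k) ∈ B → i ∉ Z → j ∉ Z → k ∉ Z →
        (i, j, k) ∈ T ∨ (i, j) ∈ F ∨ (i, k) ∈ F ∨ (j, k) ∈ F := by
  obtain ⟨T, hTB, hD, hd, hmax⟩ :=
    exists_maximal_subfamily (tripleVertex (V := V)) (triplePair (V := V)) D d B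
  refine ⟨T, hTB, ⟨hD, hd⟩,
    Finset.univ.biUnion fun i => Finset.univ.filter fun e =>
      (T.filter fun t => triplePair i t = e).card = d,
    Finset.univ.biUnion fun i => Finset.univ.filter fun v =>
      (T.filter fun t => tripleVertex i t = v).card = D, ?_, ?_, ?_⟩
  · refine (Nat.mul_le_mul_right d Finset.card_biUnion_le).trans ?_
    rw [Finset.sum_mul]
    refine (Finset.sum_le_card_nsmul _ _ T.card fun i _ => card_full_mul_le _ T d).trans ?_
    simp
  · refine (Nat.mul_le_mul_right D Finset.card_biUnion_le).trans ?_
    rw [Finset.sum_mul]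
    refine (Finset.sum_le_card_nsmul _ _ T.card fun i _ => card_full_mul_le _ T D).trans ?_
    simp
  · intro i j k hB hi hj hk
    by_contra! hc
    simp only [Finset.mem_biUnion, Finset.mem_univ, true_and, Finset.mem_filter, not_exists]
      at hi hj hk hc
    rcases hmax _ hB hc.1 with ⟨a, ha⟩ | ⟨a, ha⟩
    · fin_cases a
      exacts [hi 0 ha, hj 1 ha, hk 2 ha]
    · fin_cases a
      exacts [hc.2.1 0 ha, hc.2.2.1 1 ha, hc.2.2.2 2 ha]

/-! ### Sampling -/

section Sampling

variable {ι V : Type*} [Fintype ι]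

section Apply

variable [DecidableEq ι] [Fintype V]

theorem card_mul_sum_apply (p : ι) (g : V → ℝ) :
    (Fintype.card V : ℝ) * ∑ x : ι → V, g (x p) = (Fintype.card (ι → V) : ℝ) * ∑ a, g a := by
  have h : ∑ x : ι → V, g (x p) =
      ∑ y : V × ({j // j ≠ p} → V), g y.1 :=
    Fintype.sum_equiv (Equiv.funSplitAt p V) _ _ fun x => rfl
  rw [h, Fintype.sum_prod_type, Fintype.card_congr (Equiv.funSplitAt p V), Fintype.card_prod]
  simp only [Finset.sum_const, Finset.card_univ, nsmul_eq_mul, ← Finset.mul_sum]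
  push_cast
  ring

/-- Independence of two coordinates of a uniform sample, with denominators cleared. -/
theorem card_sq_mul_sum_apply_apply {p q : ι} (hpq : p ≠ q) (g g' : V → ℝ) :
    (Fintype.card V : ℝ) ^ 2 * ∑ x : ι → V, g (x p) * g' (x q) =
      (Fintype.card (ι → V) : ℝ) * ((∑ a, g a) * ∑ a, g' a) := by
  have h : ∑ x : ι → V, g (x p) * g' (x q) =
      ∑ y : V × ({j // j ≠ p} → V), g y.1 * g' (y.2 ⟨q, hpq.symm⟩) :=
    Fintype.sum_equiv (Equiv.funSplitAt p V) _ _ fun x => rfl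
  have h' := card_mul_sum_apply (V := V) (⟨q, hpq.symm⟩ : {j // j ≠ p}) g'
  rw [h, Fintype.sum_prod_type, Fintype.card_congr (Equiv.funSplitAt p V), Fintype.card_prod]
  simp only [← Finset.mul_sum, ← Finset.sum_mul]
  push_cast
  linear_combination (Fintype.card V : ℝ) * (∑ a, g a) * h'

end Apply

variable [DecidableEq V]

/-- The number of indices at which the sample `x` takes the value `a`. -/
def sampleCount (x : ι → V) (a : V) : ℝ := ∑ p, if x p = a then 1 else 0

theorem sampleCount_nonneg (x : ι → V) (a : V) : 0 ≤ sampleCount x a :=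
  Finset.sum_nonneg fun _ _ => by split_ifs <;> norm_num

theorem exists_of_sampleCount_pos {x : ι → V} {a : V} (h : sampleCount x a ≠ 0) :
    ∃ p, x p = a := by
  obtain ⟨p, -, hp⟩ := Finset.exists_ne_zero_of_sum_ne_zero h
  exact ⟨p, by by_contra hne; exact hp (if_neg hne)⟩

theorem sum_mul_mul_eq {X : Type*} [Fintype X] (f g h : X → ℝ) :
    ∑ ω : X × X × X, f ω.1 * (g ω.2.1 * h ω.2.2) = (∑ x, f x) * ((∑ x, g x) * ∑ x, h x) := by
  rw [Fintype.sum_prod_type]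
  simp only [Fintype.sum_prod_type, Finset.sum_mul_sum, ← Finset.mul_sum]

variable [DecidableEq ι] [Fintype V] [Nonempty V]

theorem sum_sampleCount (a : V) :
    ∑ x : ι → V, sampleCount x a =
      Fintype.card (ι → V) * ((Fintype.card ι : ℝ) / Fintype.card V) := by
  have hV : (Fintype.card V : ℝ) ≠ 0 := by exact_mod_cast Fintype.card_ne_zero
  have h : ∀ p : ι, ∑ x : ι → V, (if x p = a then (1 : ℝ) else 0) =
      Fintype.card (ι → V) / Fintype.card V := fun p => by
    rw [eq_div_iff hV, mul_comm, card_mul_sum_apply p fun b => if b = a then (1 : ℝ) else 0]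
    simp
  simp only [sampleCount]
  rw [Finset.sum_comm, Finset.sum_congr rfl fun p _ => h p, Finset.sum_const, Finset.card_univ,
    nsmul_eq_mul]
  ring

theorem sum_sampleCount_mul_le (a b : V) :
    ∑ x : ι → V, sampleCount x a * sampleCount x b ≤
      Fintype.card (ι → V) * (((Fintype.card ι : ℝ) / Fintype.card V) ^ 2 +
        if a = b then (Fintype.card ι : ℝ) / Fintype.card V else 0) := by
  have hV : (0 : ℝ) < Fintype.card V := by exact_mod_cast Fintype.card_pos
  have hdiag : ∀ p : ι, ∑ x : ι → V, (if x p = a then (1 : ℝ) else 0) * (if x p = b then 1 else 0) =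
      Fintype.card (ι → V) * if a = b then (Fintype.card V : ℝ)⁻¹ else 0 := fun p => by
    have := card_mul_sum_apply (ι := ι) p
      fun c : V => (if c = a then (1 : ℝ) else 0) * (if c = b then 1 else 0)
    have hs : ∑ c : V, (if c = a then (1 : ℝ) else 0) * (if c = b then 1 else 0) =
        if a = b then 1 else 0 := by simp [eq_comm]
    rw [hs] at this
    rw [← mul_right_inj' hV.ne', this]
    split_ifs
    · field_simp
    · simp
  have hoff : ∀ p q : ι, p ≠ q →
      ∑ x : ι → V, (if x p = a then (1 : ℝ) else 0) * (if x q = b then 1 else 0) =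
      Fintype.card (ι → V) * ((Fintype.card V : ℝ)⁻¹) ^ 2 := fun p q hpq => by
    have := card_sq_mul_sum_apply_apply hpq (fun c : V => if c = a then (1 : ℝ) else 0)
      fun c => if c = b then 1 else 0
    simp only [Finset.sum_ite_eq', Finset.mem_univ, if_true] at this
    rw [← mul_right_inj' (pow_ne_zero 2 hV.ne'), this]
    field_simp
  -- The off-diagonal value is also allowed for `p = q`. This only weakens the bound and lets the
  -- double sum be evaluated at once.
  have hpair : ∀ p q : ι,
      ∑ x : ι → V, (if x p = a then (1 : ℝ) else 0) * (if x q = b then 1 else 0) ≤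
      Fintype.card (ι → V) * ((Fintype.card V : ℝ)⁻¹) ^ 2 +
        if p = q then Fintype.card (ι → V) * (if a = b then (Fintype.card V : ℝ)⁻¹ else 0)
          else 0 := fun p q => by
    by_cases hpq : p = q
    · subst hpq
      rw [hdiag, if_pos rfl]
      have : (0 : ℝ) ≤ Fintype.card (ι → V) * ((Fintype.card V : ℝ)⁻¹) ^ 2 := by positivity
      linarith
    · rw [hoff p q hpq, if_neg hpq, add_zero]
  calc ∑ x : ι → V, sampleCount x a * sampleCount x b
      = ∑ p, ∑ q, ∑ x : ι → V, (if x p = a then (1 : ℝ) else 0) * (if x q = b then 1 else 0) := by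
        simp only [sampleCount, Finset.sum_mul_sum]
        rw [Finset.sum_comm]
        exact Finset.sum_congr rfl fun p _ => Finset.sum_comm
    _ ≤ ∑ p, ∑ q, (Fintype.card (ι → V) * ((Fintype.card V : ℝ)⁻¹) ^ 2 +
        if p = q then Fintype.card (ι → V) * (if a = b then (Fintype.card V : ℝ)⁻¹ else 0)
          else 0) := Finset.sum_le_sum fun p _ => Finset.sum_le_sum fun q _ => hpair p q
    _ = _ := by
        simp only [Finset.sum_add_distrib, Finset.sum_const, Finset.card_univ, nsmul_eq_mul,
          Finset.sum_ite_eq, Finset.mem_univ, if_true]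
        split_ifs <;> ring

/-- The number of occurrences of triples from `T` in three samples. -/
def tripleCount (T : Finset (V × V × V)) (ω : (ι → V) × (ι → V) × (ι → V)) : ℝ :=
  ∑ t ∈ T, sampleCount ω.1 t.1 * (sampleCount ω.2.1 t.2.1 * sampleCount ω.2.2 t.2.2)

theorem sum_tripleCount (T : Finset (V × V × V)) :
    ∑ ω : (ι → V) × (ι → V) × (ι → V), tripleCount T ω =
      (Fintype.card (ι → V) : ℝ) ^ 3 * (((Fintype.card ι : ℝ) / Fintype.card V) ^ 3 * T.card) := by
  simp only [tripleCount]
  rw [Finset.sum_comm]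
  have h : ∀ t : V × V × V, ∑ ω : (ι → V) × (ι → V) × (ι → V),
      sampleCount ω.1 t.1 * (sampleCount ω.2.1 t.2.1 * sampleCount ω.2.2 t.2.2) =
      (Fintype.card (ι → V) : ℝ) ^ 3 * ((Fintype.card ι : ℝ) / Fintype.card V) ^ 3 := fun t => by
    rw [sum_mul_mul_eq (fun x => sampleCount x t.1) (fun x => sampleCount x t.2.1)
      fun x => sampleCount x t.2.2]
    simp only [sum_sampleCount]
    ring
  rw [Finset.sum_congr rfl fun t _ => h t, Finset.sum_const, nsmul_eq_mul]
  ring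

/-- The three samples are independent, so the correlation of two triples is at most a product of
three factors `β ^ 2` or `β ^ 2 + β`, the latter where they agree. Expanding it produces one term
for each agreeing position, pair of positions and whole triple; the degree bounds count these. -/
theorem sum_tripleCount_sq_le (T : Finset (V × V × V)) {D d : ℕ} (hT : DegreeBounded T D d)
    {β : ℝ} (hβ : β = (Fintype.card ι : ℝ) / Fintype.card V) :
    ∑ ω : (ι → V) × (ι → V) × (ι → V), tripleCount T ω ^ 2 ≤
      (Fintype.card (ι → V) : ℝ) ^ 3 *
        (T.card * (β ^ 6 * T.card + 3 * D * β ^ 5 + 3 * d * β ^ 4 + β ^ 3)) := by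
  classical
  have hβ₀ : 0 ≤ β := by rw [hβ]; positivity
  set N : ℝ := (Fintype.card (ι → V) : ℝ) with hN
  have hN₀ : 0 ≤ N := Nat.cast_nonneg _
  have hpair : ∀ t t' : V × V × V, ∑ ω : (ι → V) × (ι → V) × (ι → V),
      (sampleCount ω.1 t.1 * (sampleCount ω.2.1 t.2.1 * sampleCount ω.2.2 t.2.2)) *
      (sampleCount ω.1 t'.1 * (sampleCount ω.2.1 t'.2.1 * sampleCount ω.2.2 t'.2.2)) ≤
      N ^ 3 * (β ^ 6 + β ^ 5 * (∑ i, if tripleVertex i t' = tripleVertex i t then 1 else 0) +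
        β ^ 4 * (∑ i, if triplePair i t' = triplePair i t then 1 else 0) +
        β ^ 3 * if t' = t then 1 else 0) := by
    rintro ⟨a, b, c⟩ ⟨a', b', c'⟩
    have h := sum_mul_mul_eq (X := ι → V) (fun x => sampleCount x a * sampleCount x a')
      (fun x => sampleCount x b * sampleCount x b') fun x => sampleCount x c * sampleCount x c'
    rw [Finset.sum_congr rfl fun ω _ => (by ring :
      (sampleCount ω.1 a * (sampleCount ω.2.1 b * sampleCount ω.2.2 c)) *
      (sampleCount ω.1 a' * (sampleCount ω.2.1 b' * sampleCount ω.2.2 c')) =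
      (sampleCount ω.1 a * sampleCount ω.1 a') * ((sampleCount ω.2.1 b * sampleCount ω.2.1 b') *
        (sampleCount ω.2.2 c * sampleCount ω.2.2 c'))), h]
    have hnn : ∀ u v : V, 0 ≤ ∑ x : ι → V, sampleCount x u * sampleCount x v := fun u v =>
      Finset.sum_nonneg fun x _ => mul_nonneg (sampleCount_nonneg _ _) (sampleCount_nonneg _ _)
    have hle : ∀ u v : V, ∑ x : ι → V, sampleCount x u * sampleCount x v ≤
        N * (β ^ 2 + if u = v then β else 0) := fun u v => by
      rw [hβ]
      exact sum_sampleCount_mul_le u v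
    have hnn' : ∀ u v : V, 0 ≤ N * (β ^ 2 + if u = v then β else 0) := fun u v =>
      (hnn u v).trans (hle u v)
    refine (mul_le_mul (hle a a') (mul_le_mul (hle b b') (hle c c') (hnn _ _) (hnn' _ _))
      (mul_nonneg (hnn _ _) (hnn _ _)) (hnn' _ _)).trans (le_of_eq ?_)
    simp only [Fin.sum_univ_three, tripleVertex, triplePair, Matrix.cons_val_zero,
      Matrix.cons_val_one, Matrix.cons_val, Prod.mk.injEq, eq_comm (a := a'), eq_comm (a := b'),
      eq_comm (a := c')]
    by_cases ha : a = a' <;> by_cases hb : b = b' <;> by_cases hc : c = c' <;>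
      simp only [ha, hb, hc, if_true, if_false, and_true, and_false, and_self] <;> ring
  have hsq : ∑ ω : (ι → V) × (ι → V) × (ι → V), tripleCount T ω ^ 2 =
      ∑ t ∈ T, ∑ t' ∈ T, ∑ ω : (ι → V) × (ι → V) × (ι → V),
      (sampleCount ω.1 t.1 * (sampleCount ω.2.1 t.2.1 * sampleCount ω.2.2 t.2.2)) *
      (sampleCount ω.1 t'.1 * (sampleCount ω.2.1 t'.2.1 * sampleCount ω.2.2 t'.2.2)) := by
    simp only [tripleCount, sq, Finset.sum_mul_sum]
    rw [Finset.sum_comm]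
    exact Finset.sum_congr rfl fun t _ => Finset.sum_comm
  have hrow : ∀ t ∈ T, ∑ t' ∈ T,
      (β ^ 6 + β ^ 5 * (∑ i, if tripleVertex i t' = tripleVertex i t then (1 : ℝ) else 0) +
        β ^ 4 * (∑ i, if triplePair i t' = triplePair i t then 1 else 0) +
        β ^ 3 * if t' = t then 1 else 0) ≤
      β ^ 6 * T.card + 3 * D * β ^ 5 + 3 * d * β ^ 4 + β ^ 3 := fun t ht => by
    simp only [Finset.sum_add_distrib, ← Finset.mul_sum]
    have h₁ : ∑ t' ∈ T, ∑ i, (if tripleVertex i t' = tripleVertex i t then (1 : ℝ) else 0) ≤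
        3 * D := by
      rw [Finset.sum_comm]
      refine (Finset.sum_le_card_nsmul _ _ (D : ℝ) fun i _ => ?_).trans (by simp)
      rw [Finset.sum_boole]
      exact_mod_cast hT.1 i _
    have h₂ : ∑ t' ∈ T, ∑ i, (if triplePair i t' = triplePair i t then (1 : ℝ) else 0) ≤
        3 * d := by
      rw [Finset.sum_comm]
      refine (Finset.sum_le_card_nsmul _ _ (d : ℝ) fun i _ => ?_).trans (by simp)
      rw [Finset.sum_boole]
      exact_mod_cast hT.2 i _
    have h₃ : ∑ t' ∈ T, (if t' = t then (1 : ℝ) else 0) = 1 := by simp [ht]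
    have h₄ : ∑ _t' ∈ T, β ^ 6 = β ^ 6 * T.card := by
      rw [Finset.sum_const, nsmul_eq_mul, mul_comm]
    rw [h₃, h₄]
    have h₅ := mul_le_mul_of_nonneg_left h₁ (pow_nonneg hβ₀ 5)
    have h₆ := mul_le_mul_of_nonneg_left h₂ (pow_nonneg hβ₀ 4)
    linarith
  rw [hsq]
  calc _ ≤ ∑ t ∈ T, ∑ t' ∈ T, N ^ 3 * (β ^ 6 +
          β ^ 5 * (∑ i, if tripleVertex i t' = tripleVertex i t then 1 else 0) +
          β ^ 4 * (∑ i, if triplePair i t' = triplePair i t then 1 else 0) +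
          β ^ 3 * if t' = t then 1 else 0) :=
        Finset.sum_le_sum fun t _ => Finset.sum_le_sum fun t' _ => hpair t t'
    _ ≤ N ^ 3 * ∑ t ∈ T, (β ^ 6 * T.card + 3 * D * β ^ 5 + 3 * d * β ^ 4 + β ^ 3) := by
        simp only [← Finset.mul_sum]
        exact mul_le_mul_of_nonneg_left (Finset.sum_le_sum hrow) (pow_nonneg hN₀ 3)
    _ = _ := by rw [Finset.sum_const, nsmul_eq_mul]

end Sampling

/-! ### Uniform probabilities -/

theorem uniformProb_mono {Ω : Type} [Fintype Ω] {A B : Ω → Prop} (h : ∀ ω, A ω → B ω) :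
    uniformProb A ≤ uniformProb B := by
  classical
  unfold uniformProb
  gcongr with ω
  exact h ω

theorem uniformProb_eq_one {Ω : Type} [Fintype Ω] [Nonempty Ω] {A : Ω → Prop} (h : ∀ ω, A ω) :
    uniformProb A = 1 := by
  classical
  unfold uniformProb
  rw [Finset.filter_true_of_mem fun ω _ => h ω, Finset.card_univ, div_self]
  exact_mod_cast Fintype.card_ne_zero

theorem uniformProb_equiv {Ω Ω' : Type} [Fintype Ω] [Fintype Ω'] (e : Ω ≃ Ω') (A : Ω' → Prop) :
    uniformProb (fun ω => A (e ω)) = uniformProb A := by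
  classical
  unfold uniformProb
  rw [Fintype.card_congr e]
  congr 2
  exact Finset.card_equiv e fun ω => by simp

theorem uniformProb_snd {Ω Ω' : Type} [Fintype Ω] [Nonempty Ω] [Fintype Ω'] (A : Ω' → Prop) :
    uniformProb (fun ω : Ω × Ω' => A ω.2) = uniformProb A := by
  classical
  unfold uniformProb
  have h : (Finset.univ.filter fun ω : Ω × Ω' => A ω.2) =
      Finset.univ ×ˢ Finset.univ.filter A := by ext; simp
  rw [h, Finset.card_product, Fintype.card_prod, Finset.card_univ]
  have : (Fintype.card Ω : ℝ) ≠ 0 := by exact_mod_cast Fintype.card_ne_zero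
  push_cast
  rw [mul_div_mul_left _ _ this]

/-- The second moment method: a large family of triples of bounded degree is hit by the sample. -/
theorem two_thirds_le_uniformProb_triple {n m : ℕ} (hn : 0 < n) (hm : 0 < m)
    {T : Finset (Fin n × Fin n × Fin n)} {D d : ℕ} (hT : DegreeBounded T D d)
    (h : 3 * D * ((m : ℝ) / n) ^ 2 + 3 * d * ((m : ℝ) / n) + 1 ≤ ((m : ℝ) / n) ^ 3 * T.card / 2) :
    2 / 3 ≤ uniformProb fun ω : (Fin m → Fin n) × (Fin m → Fin n) × (Fin m → Fin n) =>
      ∃ p q r, (ω.1 p, ω.2.1 q, ω.2.2 r) ∈ T := by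
  classical
  have : Nonempty (Fin n) := ⟨⟨0, hn⟩⟩
  set β : ℝ := (m : ℝ) / n with hβ
  have hβ₀ : 0 < β := by rw [hβ]; positivity
  set S := Finset.univ.filter fun ω : (Fin m → Fin n) × (Fin m → Fin n) × (Fin m → Fin n) =>
    ∃ p q r, (ω.1 p, ω.2.1 q, ω.2.2 r) ∈ T with hS
  have hzero : ∀ ω, ω ∉ S → tripleCount T ω = 0 := fun ω hω => by
    by_contra hne
    obtain ⟨t, ht, hne'⟩ := Finset.exists_ne_zero_of_sum_ne_zero hne
    obtain ⟨p, hp⟩ := exists_of_sampleCount_pos (left_ne_zero_of_mul hne')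
    obtain ⟨q, hq⟩ :=
      exists_of_sampleCount_pos (left_ne_zero_of_mul (right_ne_zero_of_mul hne'))
    obtain ⟨r, hr⟩ :=
      exists_of_sampleCount_pos (right_ne_zero_of_mul (right_ne_zero_of_mul hne'))
    refine hω (Finset.mem_filter.2 ⟨Finset.mem_univ _, p, q, r, ?_⟩)
    rw [hp, hq, hr]
    exact ht
  set N : ℝ := (Fintype.card (Fin m → Fin n) : ℝ) with hN
  have hN₀ : 0 < N := by
    rw [hN]
    exact_mod_cast Fintype.card_pos
  have hcount : (Fintype.card ((Fin m → Fin n) × (Fin m → Fin n) × (Fin m → Fin n)) : ℝ) =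
      N ^ 3 := by
    simp only [Fintype.card_prod]
    push_cast
    ring
  have h₁ := sum_tripleCount (ι := Fin m) T
  have h₂ := sum_tripleCount_sq_le (ι := Fin m) T hT (β := β) (by simp [hβ])
  rw [Fintype.card_fin, Fintype.card_fin, ← hβ, ← hN] at h₁
  rw [← hN] at h₂
  -- Cauchy–Schwarz on the support of the count.
  have h₃ : (∑ ω : (Fin m → Fin n) × (Fin m → Fin n) × (Fin m → Fin n), tripleCount T ω) ^ 2 ≤
      S.card * ∑ ω : (Fin m → Fin n) × (Fin m → Fin n) × (Fin m → Fin n),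
        tripleCount T ω ^ 2 := by
    rw [← Finset.sum_subset (Finset.subset_univ S) fun ω _ hω => hzero ω hω]
    refine sq_sum_le_card_mul_sum_sq.trans (mul_le_mul_of_nonneg_left ?_ (Nat.cast_nonneg _))
    exact Finset.sum_le_sum_of_subset_of_nonneg (Finset.subset_univ _) fun _ _ _ => sq_nonneg _
  have hTpos : (0 : ℝ) < T.card := by
    by_contra hc
    have h0 : (T.card : ℝ) = 0 := le_antisymm (not_lt.1 hc) (Nat.cast_nonneg _)
    rw [h0] at h
    have : (0 : ℝ) ≤ 3 * D * β ^ 2 + 3 * d * β := by positivity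
    linarith
  have h₄ : T.card * (β ^ 6 * T.card + 3 * D * β ^ 5 + 3 * d * β ^ 4 + β ^ 3) ≤
      T.card * (3 / 2 * (β ^ 6 * T.card)) := by
    have := mul_le_mul_of_nonneg_left h (pow_pos hβ₀ 3).le
    refine mul_le_mul_of_nonneg_left ?_ hTpos.le
    linarith
  have h₅ : (N ^ 3 * (β ^ 3 * T.card)) ^ 2 ≤
      S.card * (N ^ 3 * (T.card * (3 / 2 * (β ^ 6 * T.card)))) := by
    rw [← h₁]
    exact h₃.trans (mul_le_mul_of_nonneg_left
      (h₂.trans (mul_le_mul_of_nonneg_left h₄ (pow_pos hN₀ 3).le)) (Nat.cast_nonneg _))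
  unfold uniformProb
  rw [hcount, le_div_iff₀ (pow_pos hN₀ 3)]
  have hpos : 0 < N ^ 3 * (β ^ 6 * T.card ^ 2) := by positivity
  refine le_of_mul_le_mul_left ?_ hpos
  calc N ^ 3 * (β ^ 6 * T.card ^ 2) * (2 / 3 * N ^ 3)
      = 2 / 3 * (N ^ 3 * (β ^ 3 * T.card)) ^ 2 := by ring
    _ ≤ 2 / 3 * (S.card * (N ^ 3 * (T.card * (3 / 2 * (β ^ 6 * T.card))))) := by linarith
    _ = N ^ 3 * (β ^ 6 * T.card ^ 2) * S.card := by ring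
    _ = _ := by rw [hS]; congr!

/-- The last `3 * m` indices form three independent blocks in increasing order, which yields `p < q
< r`. -/
theorem two_thirds_le_uniformProb_sample {n m s : ℕ} (hn : 0 < n) (hm : 0 < m) (hs : 3 * m ≤ s)
    {T : Finset (Fin n × Fin n × Fin n)} {D d : ℕ} (hT : DegreeBounded T D d)
    (h : 3 * D * ((m : ℝ) / n) ^ 2 + 3 * d * ((m : ℝ) / n) + 1 ≤ ((m : ℝ) / n) ^ 3 * T.card / 2) :
    2 / 3 ≤ uniformProb fun S : Fin s → Fin n =>
      ∃ p q r, p < q ∧ q < r ∧ (S p, S q, S r) ∈ T := by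
  obtain ⟨k, rfl⟩ : ∃ k, s = k + (m + (m + m)) := ⟨s - 3 * m, by omega⟩
  have : Nonempty (Fin n) := ⟨⟨0, hn⟩⟩
  let e : (Fin k → Fin n) × (Fin m → Fin n) × (Fin m → Fin n) × (Fin m → Fin n) ≃
      (Fin (k + (m + (m + m))) → Fin n) :=
    ((Equiv.refl _).prodCongr (((Equiv.refl _).prodCongr (Fin.appendEquiv m m)).trans
      (Fin.appendEquiv m (m + m)))).trans (Fin.appendEquiv k (m + (m + m)))
  rw [← uniformProb_equiv e]
  refine (two_thirds_le_uniformProb_triple hn hm hT h).trans ?_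
  rw [← uniformProb_snd (Ω := Fin k → Fin n)]
  refine uniformProb_mono ?_
  rintro ⟨w, x, y, z⟩ ⟨p, q, r, hpqr⟩
  refine ⟨Fin.natAdd k (Fin.castAdd (m + m) p), Fin.natAdd k (Fin.natAdd m (Fin.castAdd m q)),
    Fin.natAdd k (Fin.natAdd m (Fin.natAdd m r)), ?_, ?_, ?_⟩
  · rw [Fin.lt_def]; simp; omega
  · rw [Fin.lt_def]; simp; omega
  · simpa [e, Fin.appendEquiv, -Fin.natAdd_eq_addNat] using hpqr

/-! ### Running the tester -/

namespace QueryTree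

variable {n : ℕ} {α β : Type} (M : Matrix (Fin n) (Fin n) ℝ)

theorem run_bind (t : QueryTree n α) (f : α → QueryTree n β) :
    (t.bind f).run M = (f (t.run M)).run M := by
  induction t with
  | done a => rfl
  | ask i j next ih => exact ih (M i j)

theorem queries_bind (t : QueryTree n α) (f : α → QueryTree n β) :
    (t.bind f).queries M = t.queries M + (f (t.run M)).queries M := by
  induction t with
  | done a => simp [bind, queries, run]
  | ask i j next ih =>
    simp only [bind, queries, run]
    rw [ih]
    ring

end QueryTree

section Tester

variable {n : ℕ} (M : Matrix (Fin n) (Fin n) ℝ)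

theorem queries_checkPairs_le (l : List (Fin n × CliqueEdge n)) :
    (checkPairs l).queries M ≤ 3 * l.length := by
  induction l with
  | nil => simp [checkPairs, QueryTree.queries]
  | cons a l ih =>
    obtain ⟨v, e⟩ := a
    simp only [checkPairs, QueryTree.queries, List.length_cons]
    split_ifs
    · simp [QueryTree.queries]
    · omega

theorem run_checkPairs_of_isGraphMetric {M : Matrix (Fin n) (Fin n) ℝ} (hM : IsGraphMetric M)
    (l : List (Fin n × CliqueEdge n)) : (checkPairs l).run M = false := by
  induction l with
  | nil => rfl
  | cons a l ih =>
    obtain ⟨v, e⟩ := a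
    simp only [checkPairs, QueryTree.run]
    rw [if_neg, ih]
    rw [badWeights_iff_not_goodTriple, not_not]
    exact hM.goodTriple _ _ _

theorem queries_queryTable (l : List (Fin n × Fin n)) :
    (queryTable l).queries M = l.length := by
  induction l with
  | nil => rfl
  | cons a l ih =>
    obtain ⟨i, j⟩ := a
    simp [queryTable, QueryTree.queries, QueryTree.queries_bind, ih]

theorem run_queryTable (l : List (Fin n × Fin n)) {a b : Fin n} (h : (a, b) ∈ l) :
    (queryTable l).run M a b = M a b := by
  induction l with
  | nil => simp at h
  | cons p l ih =>
    obtain ⟨i, j⟩ := p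
    simp only [queryTable, QueryTree.run, QueryTree.run_bind]
    split_ifs with hab
    · rw [hab.1, hab.2]
    · rcases List.mem_cons.1 h with h | h
      · rw [Prod.mk.injEq] at h
        exact absurd h hab
      · exact ih h

/-- The positions queried in the second phase. -/
def samplePairs {s : ℕ} (S : Fin s → Fin n) : List (Fin n × Fin n) :=
  ((List.finRange s ×ˢ List.finRange s).filter fun p => p.1 < p.2).map fun p => (S p.1, S p.2)

/-- With `p < q` the position was queried in exactly this order, so the default value `0` is not
read and no symmetry of `M` is needed. -/
theorem run_queryTable_samplePairs {s : ℕ} (S : Fin s → Fin n) {p q : Fin s} (h : p < q) :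
    (queryTable (samplePairs S)).run M (S p) (S q) = M (S p) (S q) := by
  refine run_queryTable M _ (List.mem_map.2 ⟨(p, q), ?_, rfl⟩)
  simp [h]

theorem length_samplePairs_le {s : ℕ} (S : Fin s → Fin n) : (samplePairs S).length ≤ s ^ 2 := by
  rw [samplePairs, List.length_map]
  refine (List.length_filter_le _ _).trans (le_of_eq ?_)
  rw [List.length_product, List.length_finRange, sq]

open Classical in
theorem run_badTriangleDetection {k m s : ℕ} (V' : Fin k → Fin n) (E' : Fin m → CliqueEdge n)
    (S : Fin s → Fin n) :
    (badTriangleDetection V' E' S).run M =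
      if (highDegreeDetection V' E').run M = true ∨
        ∃ p q r : Fin s, p < q ∧ q < r ∧ ¬ GoodTriple M (S p) (S q) (S r)
      then .nonMetric else .metric := by
  have hT : (∃ p q r : Fin s, p < q ∧ q < r ∧
      BadWeights ((queryTable (samplePairs S)).run M (S p) (S q))
        ((queryTable (samplePairs S)).run M (S p) (S r))
        ((queryTable (samplePairs S)).run M (S q) (S r))) ↔
      ∃ p q r : Fin s, p < q ∧ q < r ∧ ¬ GoodTriple M (S p) (S q) (S r) := by
    refine exists_congr fun p => exists_congr fun q => exists_congr fun r =>
      and_congr_right fun hpq => and_congr_right fun hqr => ?_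
    rw [run_queryTable_samplePairs M S hpq, run_queryTable_samplePairs M S hqr,
      run_queryTable_samplePairs M S (hpq.trans hqr), badWeights_iff_not_goodTriple]
  rw [badTriangleDetection, QueryTree.run_bind]
  split_ifs with h₁ h₂ h₂
  · rfl
  · exact absurd (Or.inl h₁) h₂
  · rw [QueryTree.run_bind]
    change QueryTree.run M (if _ then _ else _) = _
    rw [if_pos]
    · rfl
    · exact hT.2 (h₂.resolve_left h₁)
  · rw [QueryTree.run_bind]
    change QueryTree.run M (if _ then _ else _) = _
    rw [if_neg]
    · rfl
    · exact fun h => h₂ (Or.inr (hT.1 h))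

theorem queries_badTriangleDetection_le {k m s : ℕ} (V' : Fin k → Fin n)
    (E' : Fin m → CliqueEdge n) (S : Fin s → Fin n) :
    (badTriangleDetection V' E' S).queries M ≤ 3 * (k * m) + s ^ 2 := by
  rw [badTriangleDetection, QueryTree.queries_bind]
  refine add_le_add ?_ ?_
  · refine (queries_checkPairs_le M _).trans (le_of_eq ?_)
    rw [List.length_map, List.length_product, List.length_finRange, List.length_finRange]
  · split_ifs
    · simp [QueryTree.queries]
    · rw [QueryTree.queries_bind, queries_queryTable]
      refine le_trans ?_ (length_samplePairs_le S)
      rw [samplePairs]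
      split_ifs <;> simp [QueryTree.queries]

end Tester

/-! ### The number of queries, and completeness -/

/-- Here `156 = 3 * 4 * 13`, where `4`, `13` and `C + 1` absorb the roundings. The exponent `1.1` is
merely weakened to `2`. -/
theorem queries_metricTesting_le {C : ℝ} (hC : 0 ≤ C) {n : ℕ} {ε : ℝ} (hn : 2 ≤ n) (hε : 0 < ε)
    (hε1 : ε ≤ 1) (M : Matrix (Fin n) (Fin n) ℝ) (ω : Seed C n ε) :
    ((metricTesting C n ε ω).queries M : ℝ) ≤
      (156 + (C + 1) ^ 2) * ((n : ℝ) ^ (2 / 3 : ℝ) / ε ^ 2) := by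
  have hn1 : (1 : ℝ) ≤ n := by exact_mod_cast (by omega : 1 ≤ n)
  have hV : (numVertices ε : ℝ) ≤ 4 / ε ^ 2 := by
    have h₁ : ε ^ 2 ≤ ε ^ (1.1 : ℝ) := by
      rw [← Real.rpow_natCast ε 2]
      exact Real.rpow_le_rpow_of_exponent_ge hε hε1 (by norm_num)
    have h₂ : 3 / ε ^ (1.1 : ℝ) ≤ 3 / ε ^ 2 := by gcongr
    have h₃ : 1 ≤ 1 / ε ^ 2 := by
      rw [le_div_iff₀ (by positivity), one_mul]
      exact pow_le_one₀ hε.le hε1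
    have h₄ : (numVertices ε : ℝ) ≤ 3 / ε ^ (1.1 : ℝ) + 1 :=
      (Nat.ceil_lt_add_one (by positivity)).le
    have h₅ : 4 / ε ^ 2 = 3 / ε ^ 2 + 1 / ε ^ 2 := by ring
    linarith
  have hE : (numEdges n : ℝ) ≤ 13 * (n : ℝ) ^ (2 / 3 : ℝ) := by
    have h₁ : (1 : ℝ) ≤ (n : ℝ) ^ (2 / 3 : ℝ) := Real.one_le_rpow hn1 (by norm_num)
    have h₂ : (numEdges n : ℝ) ≤ 12 * (n : ℝ) ^ (2 / 3 : ℝ) + 1 :=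
      (Nat.ceil_lt_add_one (by positivity)).le
    linarith
  have hS : (numSamples C n ε : ℝ) ≤ (C + 1) * ((n : ℝ) ^ (1 / 3 : ℝ) / ε) := by
    have h₁ : (1 : ℝ) ≤ (n : ℝ) ^ (1 / 3 : ℝ) := Real.one_le_rpow hn1 (by norm_num)
    have h₂ : 1 ≤ (n : ℝ) ^ (1 / 3 : ℝ) / ε := by
      rw [le_div_iff₀ hε]
      linarith
    have h₃ : (numSamples C n ε : ℝ) ≤ C * (n : ℝ) ^ (1 / 3 : ℝ) / ε + 1 :=
      (Nat.ceil_lt_add_one (by positivity)).le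
    have h₄ : C * (n : ℝ) ^ (1 / 3 : ℝ) / ε = C * ((n : ℝ) ^ (1 / 3 : ℝ) / ε) := by ring
    linarith
  have hsq : ((n : ℝ) ^ (1 / 3 : ℝ)) ^ 2 = (n : ℝ) ^ (2 / 3 : ℝ) := by
    rw [← Real.rpow_natCast, ← Real.rpow_mul (by positivity)]
    norm_num
  calc ((metricTesting C n ε ω).queries M : ℝ)
      ≤ 3 * (numVertices ε * numEdges n) + (numSamples C n ε : ℝ) ^ 2 := by
        exact_mod_cast queries_badTriangleDetection_le M ω.1 ω.2.1 ω.2.2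
    _ ≤ 3 * (4 / ε ^ 2 * (13 * (n : ℝ) ^ (2 / 3 : ℝ))) +
        ((C + 1) * ((n : ℝ) ^ (1 / 3 : ℝ) / ε)) ^ 2 := by gcongr
    _ = _ := by
        rw [mul_pow, div_pow, hsq]
        ring

theorem nonempty_seed {C : ℝ} {n : ℕ} (ε : ℝ) (hn : 2 ≤ n) : Nonempty (Seed C n ε) := by
  have : Nonempty (Fin n) := ⟨⟨0, by omega⟩⟩
  have : Nonempty (CliqueEdge n) :=
    ⟨⟨(⟨0, by omega⟩, ⟨1, by omega⟩), by simp [Fin.lt_def]⟩⟩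
  infer_instance

theorem outputProb_metric_eq_one {C : ℝ} {n : ℕ} {ε : ℝ} (hn : 2 ≤ n)
    {M : Matrix (Fin n) (Fin n) ℝ} (hM : IsGraphMetric M) :
    outputProb C ε M Verdict.metric = 1 := by
  have := nonempty_seed (C := C) ε hn
  refine uniformProb_eq_one fun ω => ?_
  rw [metricTesting, run_badTriangleDetection, if_neg]
  rintro (h | ⟨p, q, r, -, -, h⟩)
  · rw [highDegreeDetection, run_checkPairs_of_isGraphMetric hM] at h
    exact Bool.false_ne_true h
  · exact h (hM.goodTriple _ _ _)

/-! ### Soundness -/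

/-- A rejection in the first phase can only help, so the sample of the second phase suffices. -/
theorem two_thirds_le_outputProb {C : ℝ} {n : ℕ} {ε : ℝ} (hn : 2 ≤ n)
    {M : Matrix (Fin n) (Fin n) ℝ} {T : Finset (Fin n × Fin n × Fin n)}
    (hbad : ∀ t ∈ T, ¬ GoodTriple M t.1 t.2.1 t.2.2) {D d m : ℕ} (hT : DegreeBounded T D d)
    (hm : 0 < m) (hs : 3 * m ≤ numSamples C n ε)
    (h : 3 * D * ((m : ℝ) / n) ^ 2 + 3 * d * ((m : ℝ) / n) + 1 ≤ ((m : ℝ) / n) ^ 3 * T.card / 2) :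
    2 / 3 ≤ outputProb C ε M Verdict.nonMetric := by
  have : Nonempty (Fin n) := ⟨⟨0, by omega⟩⟩
  have : Nonempty (CliqueEdge n) :=
    ⟨⟨(⟨0, by omega⟩, ⟨1, by omega⟩), by simp [Fin.lt_def]⟩⟩
  refine (two_thirds_le_uniformProb_sample (by omega) hm hs hT h).trans ?_
  rw [← uniformProb_snd (Ω := Fin (numEdges n) → CliqueEdge n),
    ← uniformProb_snd (Ω := Fin (numVertices ε) → Fin n)]
  refine uniformProb_mono ?_
  rintro ⟨V', E', S⟩ ⟨p, q, r, hpq, hqr, hS⟩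
  rw [metricTesting, run_badTriangleDetection, if_pos (Or.inr ⟨p, q, r, hpq, hqr, hbad _ hS⟩)]

/-! ### Choice of parameters -/

theorem sample_condition_of_small {x : ℝ} (hx : 10 ≤ x) : 3 * x ^ 2 + 3 * x + 1 ≤ x ^ 3 / 2 := by
  nlinarith [mul_nonneg (sub_nonneg.2 hx) (sq_nonneg x), mul_self_nonneg x]

/-- The hypothesis of the second moment method for the parameters of the tester, where `t` is the
cube root of the number of vertices. -/
theorem sample_condition_of_large {ε t m D d τ : ℝ} (hε : 0 < ε) (ht : 1 ≤ t)
    (hεt : 200 ≤ ε * t ^ 2) (hm : 2500 * t ≤ m * ε) (hD : D ≤ 3 / 2 * (ε ^ 2 * t ^ 3) + 1)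
    (hd : d ≤ ε * t ^ 2 + 1) (hτ : ε ^ 3 * t ^ 6 / 32 ≤ τ) :
    3 * D * (m / t ^ 3) ^ 2 + 3 * d * (m / t ^ 3) + 1 ≤ (m / t ^ 3) ^ 3 * τ / 2 := by
  have ht₀ : 0 < t := by linarith
  -- In terms of `y`, the sample size in units of `n^(1/3) / ε`, the claim reduces to `15 / 2 * y ^
  -- 2 + 6 * y + 1 ≤ y ^ 3 / 64`.
  set y := m * ε / t with hy
  have hy₁ : 2500 ≤ y := by rwa [hy, le_div_iff₀ ht₀]
  have hx : m / t ^ 3 = y / (ε * t ^ 2) := by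
    rw [hy]
    field_simp
  have hx₀ : 0 < m / t ^ 3 := by
    rw [hx]
    positivity
  have h₁ : 3 * d * (m / t ^ 3) ≤ 6 * y := by
    have : 3 * d * (m / t ^ 3) ≤ 3 * (2 * (ε * t ^ 2)) * (m / t ^ 3) := by
      gcongr
      linarith
    refine this.trans (le_of_eq ?_)
    rw [hx]
    field_simp
    ring
  have h₂ : 3 * D * (m / t ^ 3) ^ 2 ≤ 15 / 2 * y ^ 2 := by
    have hle : 3 / 2 * (ε ^ 2 * t ^ 3) + 1 ≤ 5 / 2 * (ε * t ^ 2) ^ 2 := by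
      have h₃ : ε ^ 2 * t ^ 3 ≤ (ε * t ^ 2) ^ 2 := by
        have := pow_le_pow_right₀ ht (show 3 ≤ 4 by norm_num)
        have := mul_le_mul_of_nonneg_left this (sq_nonneg ε)
        linarith [(by ring : (ε * t ^ 2) ^ 2 = ε ^ 2 * t ^ 4)]
      nlinarith
    have : 3 * D * (m / t ^ 3) ^ 2 ≤ 3 * (5 / 2 * (ε * t ^ 2) ^ 2) * (m / t ^ 3) ^ 2 := by
      gcongr
      linarith
    refine this.trans (le_of_eq ?_)
    rw [hx]
    field_simp
    ring
  have h₃ : y ^ 3 / 64 ≤ (m / t ^ 3) ^ 3 * τ / 2 := by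
    have : (m / t ^ 3) ^ 3 * (ε ^ 3 * t ^ 6 / 32) / 2 ≤ (m / t ^ 3) ^ 3 * τ / 2 := by gcongr
    refine le_trans (le_of_eq ?_) this
    rw [hx]
    field_simp
    ring
  have h₄ : 15 / 2 * y ^ 2 + 6 * y + 1 ≤ y ^ 3 / 64 := by
    nlinarith [mul_nonneg (sub_nonneg.2 hy₁) (sq_nonneg y)]
  linarith

/-- The bound of the repair theorem for the parameters of the tester. -/
theorem repair_bound {ε t z f H τ w : ℝ} (hε : 0 < ε) (hε1 : ε ≤ 1) (ht : 1 ≤ t)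
    (hεt : 200 ≤ ε * t ^ 2) (hf₀ : 0 ≤ f) (hτ : τ ≤ ε ^ 3 * t ^ 6 / 32)
    (hz : z * (3 / 2 * (ε ^ 2 * t ^ 3)) ≤ 3 * τ) (hf : f * (ε * t ^ 2) ≤ 3 * τ) (hH : H ≤ 3 * t)
    (hw₁ : ε * t ^ 3 / 4 ≤ w) (hw₂ : w ≤ ε * t ^ 3 / 2) :
    2 * (z * t ^ 3) + 6 * (f * H) + t ^ 3 * (τ / w) + w ^ 2 < ε * (t ^ 3) ^ 2 := by
  have ht₀ : 0 < t := by linarith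
  have hpos : 0 < ε * (t ^ 3) ^ 2 := by positivity
  have hw₀ : 0 < w := lt_of_lt_of_le (by positivity) hw₁
  -- The term `f * H` has order `ε ^ 2 * t ^ 5`; this spare factor of `t` brings it within budget.
  -- The four terms take shares `1/8`, `1/8`, `1/8` and `1/4` of `ε n²`.
  have ht14 : 14 ≤ t := by nlinarith [mul_le_mul_of_nonneg_right hε1 (sq_nonneg t)]
  have hε2 : ε ^ 2 * (t ^ 3) ^ 2 ≤ ε * (t ^ 3) ^ 2 := by
    have : ε ^ 2 ≤ ε := by nlinarith
    gcongr
  have h₁ : 2 * (z * t ^ 3) ≤ ε * (t ^ 3) ^ 2 / 8 := by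
    have hz' : z ≤ ε * t ^ 3 / 16 := by
      have hc : 0 < 3 / 2 * (ε ^ 2 * t ^ 3) := by positivity
      refine le_of_mul_le_mul_right ?_ hc
      refine hz.trans (le_trans (by linarith : 3 * τ ≤ 3 * (ε ^ 3 * t ^ 6 / 32)) (le_of_eq ?_))
      ring
    have := mul_le_mul_of_nonneg_right hz' (pow_pos ht₀ 3).le
    linarith [(by ring : ε * t ^ 3 / 16 * t ^ 3 = ε * (t ^ 3) ^ 2 / 16)]
  have h₂ : 6 * (f * H) ≤ ε * (t ^ 3) ^ 2 / 8 := by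
    have hf' : f ≤ 3 / 32 * (ε ^ 2 * t ^ 4) := by
      have hc : 0 < ε * t ^ 2 := by positivity
      refine le_of_mul_le_mul_right ?_ hc
      refine hf.trans (le_trans (by linarith : 3 * τ ≤ 3 * (ε ^ 3 * t ^ 6 / 32)) (le_of_eq ?_))
      ring
    have hfH : f * H ≤ 3 / 32 * (ε ^ 2 * t ^ 4) * (3 * t) :=
      (mul_le_mul_of_nonneg_left hH hf₀).trans (mul_le_mul_of_nonneg_right hf' (by positivity))
    have hb : ε ^ 2 * t ^ 5 * 14 ≤ ε ^ 2 * (t ^ 3) ^ 2 := by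
      have := mul_le_mul_of_nonneg_left ht14 (by positivity : 0 ≤ ε ^ 2 * t ^ 5)
      linarith [(by ring : ε ^ 2 * t ^ 5 * t = ε ^ 2 * (t ^ 3) ^ 2)]
    linarith [(by ring : 3 / 32 * (ε ^ 2 * t ^ 4) * (3 * t) = 9 / 32 * (ε ^ 2 * t ^ 5))]
  have h₃ : t ^ 3 * (τ / w) ≤ ε * (t ^ 3) ^ 2 / 8 := by
    have : τ / w ≤ ε ^ 2 * t ^ 3 / 8 := by
      rw [div_le_iff₀ hw₀]
      have := mul_le_mul_of_nonneg_left hw₁ (by positivity : 0 ≤ ε ^ 2 * t ^ 3 / 8)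
      linarith [(by ring : ε ^ 2 * t ^ 3 / 8 * (ε * t ^ 3 / 4) = ε ^ 3 * t ^ 6 / 32)]
    have := mul_le_mul_of_nonneg_left this (pow_pos ht₀ 3).le
    linarith [(by ring : t ^ 3 * (ε ^ 2 * t ^ 3 / 8) = ε ^ 2 * (t ^ 3) ^ 2 / 8)]
  have h₄ : w ^ 2 ≤ ε * (t ^ 3) ^ 2 / 4 := by
    have := pow_le_pow_left₀ hw₀.le hw₂ 2
    linarith [(by ring : (ε * t ^ 3 / 2) ^ 2 = ε ^ 2 * (t ^ 3) ^ 2 / 4)]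
  linarith

/-- The conditional positivity in `hfar` lets one statement serve graph metrics and strict metrics.
-/
theorem two_thirds_le_outputProb_of_far {C : ℝ} (hC : 10000 ≤ C) {n : ℕ} {ε : ℝ} (hn : 2 ≤ n)
    (hε : 0 < ε) (hε1 : ε ≤ 1) {M : Matrix (Fin n) (Fin n) ℝ} (hM : IsWeightedClique M)
    (hfar : ∀ M', IsGraphMetric M' →
      ((∀ i j, i ≠ j → 0 < M i j) → ∀ i j, i ≠ j → 0 < M' i j) →
      ε * (n : ℝ) ^ 2 ≤ (l0Dist M M' : ℝ)) :
    2 / 3 ≤ outputProb C ε M Verdict.nonMetric := by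
  classical
  have hn1 : (1 : ℝ) ≤ n := by exact_mod_cast (by omega : 1 ≤ n)
  obtain ⟨t, ht, htn, hs⟩ : ∃ t : ℝ, 1 ≤ t ∧ (n : ℝ) = t ^ 3 ∧ C * t / ε ≤ numSamples C n ε := by
    refine ⟨(n : ℝ) ^ (1 / 3 : ℝ), Real.one_le_rpow hn1 (by norm_num), ?_, Nat.le_ceil _⟩
    rw [← Real.rpow_natCast, ← Real.rpow_mul (by positivity)]
    norm_num
  have ht₀ : 0 < t := by linarith
  -- A block is a third of the sample. Rounding down loses less than the gap between `10000` and `3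
  -- * 2500`.
  obtain ⟨m, hsm, hm⟩ : ∃ m : ℕ, 3 * m ≤ numSamples C n ε ∧ 2500 * t ≤ m * ε := by
    refine ⟨numSamples C n ε / 3, by omega, ?_⟩
    have h₁ : (numSamples C n ε : ℝ) ≤ 3 * ((numSamples C n ε / 3 : ℕ) : ℝ) + 2 := by
      exact_mod_cast (by omega : numSamples C n ε ≤ 3 * (numSamples C n ε / 3) + 2)
    have h₂ : C * t ≤ numSamples C n ε * ε := by rwa [div_le_iff₀ hε] at hs
    have h₃ : (numSamples C n ε : ℝ) * ε ≤ (3 * ((numSamples C n ε / 3 : ℕ) : ℝ) + 2) * ε := by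
      gcongr
    nlinarith
  have hm₀ : 0 < m := by
    refine Nat.pos_of_ne_zero fun h => ?_
    rw [h, Nat.cast_zero, zero_mul] at hm
    linarith
  -- If `ε n^(2/3) < 200`, each block has at least `10 n` draws, and a single bad triple is enough.
  rcases lt_or_ge (ε * t ^ 2) 200 with hsmall | hlarge
  · obtain ⟨i, j, k, hb⟩ : ∃ i j k, ¬ GoodTriple M i j k := by
      by_contra! hc
      have h := hfar M (hM.isGraphMetric_of_goodTriple hc) id
      have h₀ : l0Dist M M = 0 := by simp [l0Dist]
      rw [h₀, Nat.cast_zero] at h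
      have : 0 < ε * (n : ℝ) ^ 2 := by positivity
      linarith
    have hdeg : DegreeBounded {(i, j, k)} 1 1 :=
      ⟨fun _ _ => (Finset.card_filter_le _ _).trans (by simp),
        fun _ _ => (Finset.card_filter_le _ _).trans (by simp)⟩
    refine two_thirds_le_outputProb hn (T := {(i, j, k)}) (by simpa using hb) hdeg hm₀ hsm ?_
    have hx : 10 ≤ (m : ℝ) / n := by
      rw [le_div_iff₀ (by linarith), htn]
      have h₁ : 10 * t ^ 3 * ε ≤ 2000 * t := by nlinarith
      have h₂ : 10 * t ^ 3 * ε ≤ m * ε := by linarith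
      exact le_of_mul_le_mul_right h₂ hε
    have := sample_condition_of_small hx
    simpa using this
  · let B := Finset.univ.filter fun u : Fin n × Fin n × Fin n => ¬ GoodTriple M u.1 u.2.1 u.2.2
    obtain ⟨T, hTB, hdeg, F, Z, hF, hZ, hcover⟩ := exists_degreeBounded_cover B
      ⌈3 / 2 * (ε ^ 2 * t ^ 3)⌉₊ ⌈ε * t ^ 2⌉₊
    rcases le_or_gt (ε ^ 3 * t ^ 6 / 32) (T.card : ℝ) with hT | hT
    · refine two_thirds_le_outputProb hn (fun u hu => (Finset.mem_filter.1 (hTB hu)).2) hdeg hm₀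
        hsm ?_
      rw [htn]
      exact sample_condition_of_large hε ht hlarge hm
        (Nat.ceil_lt_add_one (by positivity)).le (Nat.ceil_lt_add_one (by positivity)).le hT
    · exfalso
      -- This leaves room for rounding up the stopping size `w`, about `ε n / 4`, below `ε n / 2`.
      have hεn : 200 ≤ ε * t ^ 3 := by nlinarith
      have hw₁ : ε * t ^ 3 / 4 ≤ (⌈ε * t ^ 3 / 4⌉₊ : ℝ) := Nat.le_ceil _
      have hw₂ : (⌈ε * t ^ 3 / 4⌉₊ : ℝ) ≤ ε * t ^ 3 / 2 := by
        have := Nat.ceil_lt_add_one (by positivity : 0 ≤ ε * t ^ 3 / 4)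
        linarith
      obtain ⟨M', hM', hpos, hdist⟩ := exists_isGraphMetric_l0Dist_le hM T F Z
        (fun i j k hb => hcover i j k (by simpa [B] using hb))
        (Nat.ceil_pos.2 (by positivity : 0 < ε * t ^ 3 / 4))
      -- The crude bound `1 + 3 log t ≤ 3 t` suffices, as the pair term has a factor `n^(1/3)` to
      -- spare.
      have hH : (harmonic n : ℝ) ≤ 3 * t := by
        have h₁ := harmonic_le_one_add_log n
        rw [htn, Real.log_pow] at h₁
        have h₂ := Real.log_le_sub_one_of_pos ht₀
        push_cast at h₁
        linarith
      have hZ' : (Z.card : ℝ) * (3 / 2 * (ε ^ 2 * t ^ 3)) ≤ 3 * T.card :=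
        (mul_le_mul_of_nonneg_left (Nat.le_ceil _) (Nat.cast_nonneg _)).trans
          (by exact_mod_cast hZ)
      have hF' : (F.card : ℝ) * (ε * t ^ 2) ≤ 3 * T.card :=
        (mul_le_mul_of_nonneg_left (Nat.le_ceil _) (Nat.cast_nonneg _)).trans
          (by exact_mod_cast hF)
      have hbound := repair_bound hε hε1 ht hlarge (Nat.cast_nonneg F.card) hT.le hZ' hF' hH
        hw₁ hw₂
      rw [← htn] at hbound
      rw [← htn] at hdist
      exact absurd (hfar M' hM' hpos) (not_le.2 (hdist.trans_lt hbound))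

theorem mainTheorem1 :
    ∃ C₀ : ℝ, 0 < C₀ ∧ ∀ C : ℝ, C₀ ≤ C → ∃ K : ℝ, 0 < K ∧
      ∀ (n : ℕ) (ε : ℝ), 2 ≤ n → 0 < ε → ε ≤ 1 →
        (∀ (M : Matrix (Fin n) (Fin n) ℝ) (ω : Seed C n ε),
          ((metricTesting C n ε ω).queries M : ℝ) ≤ K * ((n : ℝ) ^ (2 / 3 : ℝ) / ε ^ 2)) ∧
        (∀ M : Matrix (Fin n) (Fin n) ℝ, IsGraphMetric M →
          outputProb C ε M Verdict.metric = 1) ∧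
        (∀ M : Matrix (Fin n) (Fin n) ℝ, IsWeightedClique M → IsFar ε IsGraphMetric M →
          2 / 3 ≤ outputProb C ε M Verdict.nonMetric) ∧
        (∀ M : Matrix (Fin n) (Fin n) ℝ, IsWeightedClique M → (∀ i j, i ≠ j → 0 < M i j) →
          IsFar ε IsMetric M → 2 / 3 ≤ outputProb C ε M Verdict.nonMetric) := by
  refine ⟨10000, by norm_num, fun C hC => ⟨156 + (C + 1) ^ 2, by positivity,
    fun n ε hn hε hε1 => ⟨?_, ?_, ?_, ?_⟩⟩⟩
  · exact queries_metricTesting_le (by linarith) hn hε hε1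
  · exact fun M hM => outputProb_metric_eq_one hn hM
  · exact fun M hM hfar =>
      two_thirds_le_outputProb_of_far hC hn hε hε1 hM fun M' hM' _ => hfar M' hM'
  · exact fun M hM hpos hfar =>
      two_thirds_le_outputProb_of_far hC hn hε hε1 hM fun M' hM' h =>
        hfar M' { hM' with pos := h hpos }
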